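/- Let $W$ be the set of functions $\phi(x)=\int_{\mathbb R}e^{ixy}\,d\mu(y)$, $x\in\mathbb R$, with $\mu$ a complex Borel measure on $\mathbb R$ of finite total variation, and put $\|\phi\|_W=\operatorname{var}\mu$. Let $W^+\subset W$ be the set of those $\phi$ for which $\mu$ is positive (the positive definite functions in $W$), and let $W_0\subset W$ be the set of functions $\phi(x)=\int_{\mathbb R}e^{ixy}g(y)\,dy$ with $g\in L_1(\mathbb R)$. Let $\mathbb T=[-\pi,\pi)$. A function of bounded variation on $\mathbb T$ is a function $F:\mathbb R\to\mathbb C$ that is of bounded variation on bounded intervals, for which $F(t+2\pi)-F(t)$ is constant, and which is normalized at its jumps so that $F(t)$ lies on the segment between $F(t-)$ and $F(t+)$ for every $t$. Let $V(F)$ be its total variation over the period $[-\pi,\pi]$, and let $dF$ be the associated Stieltjes measure on $\mathbb T$. We say that $\sum_{k\in\mathbb Z}c_ke^{ikt}$ is the Fourier–Stieltjes series of $dF$ if $c_k=\int_{\mathbb T}e^{-ikt}\,dF(t)$ for all $k\in\mathbb Z$ (the usual factor $\frac1{2\pi}$ is absorbed in $F$), and that it is a Fourier series if $c_k=\frac1{2\pi}\int_{\mathbb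 T}f(t)e^{-ikt}\,dt$ for all $k\in\mathbb Z$, for some $f\in L_1(\mathbb T)$. **Theorem.** Let $(c_k)_{k\in\mathbb Z}$ be a sequence of complex numbers. 1. The series $\sum c_ke^{ikt}$ is the Fourier–Stieltjes series of $dF$ for some $F$ of bounded variation on $\mathbb T$ if and only if there is $\phi\in W$ with $\phi(k)=c_k$ for all $k\in\mathbb Z$. It is a Fourier series if and only if there is $\phi\in W_0$ with $\phi(k)=c_k$ for all $k\in\mathbb Z$. Suppose now that $\sum c_ke^{ikt}$ is the Fourier–Stieltjes series of $dF$, and let $\phi_0(x)=\int_{\mathbb T}e^{-ixt}\,dF(t)$, $x\in\mathbb R$. 2. $V(F)=\min\|\phi\|_W$, where the minimum is taken over all $\phi\in W$ with $\phi(k)=c_k$ for all $k\in\mathbb Z$, and it is attained at $\phi_0$. If the series is a Fourier series, then $\phi_0\in W_0$, so that the minimum is also the minimum over all such $\phi\in W_0$. 3. The functions $\phi\in W$ with $\phi(k)=c_k$ for all $k\in\mathbb Z$ that are restrictions to $\mathbb R$ of entire functions of exponential type not exceeding $\pi$ are exactly the functions $\phi_0(x)+\lambda\sin\pi x$ with $\lambda\in\mathbb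 C$. 4. $F$ is increasing (that is, $F(t)-F(s)$ is real and $\ge0$ whenever $s\le t$) if and only if there is $\phi\in W^+$ with $\phi(k)=c_k$ for all $k\in\mathbb Z$. -/

import Mathlib

open MeasureTheory Set Real

namespace WienerSeries

noncomputable section

/-- The Fourier–Stieltjes integral `x ↦ ∫ e^{ixy} dμ(y)` of a complex Borel measure on `ℝ`. -/
def fourierStieltjes (μ : ComplexMeasure ℝ) (x : ℝ) : ℂ :=
  μ.integral (fun y : ℝ => Complex.exp (Complex.I * x * y)) (ContinuousLinearMap.mul ℝ ℂ)

/-- `μ` is a complex Borel measure of finite total variation with `φ(x) = ∫ e^{ixy} dμ(y)`. -/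
def Represents (μ : ComplexMeasure ℝ) (φ : ℝ → ℂ) : Prop :=
  μ.variation univ < ⊤ ∧ ∀ x, φ x = fourierStieltjes μ x

/-- The algebra `W` of Fourier transforms of complex measures of finite variation. -/
def W : Set (ℝ → ℂ) := {φ | ∃ μ : ComplexMeasure ℝ, Represents μ φ}

/-- The norm of `φ ∈ W`: the total variation of the representing measure. The representing
measure is unique, so the infimum is over a single value; it gives a name to that value. -/
def wNorm (φ : ℝ → ℂ) : ℝ :=
  sInf {r : ℝ | ∃ μ : ComplexMeasure ℝ, Represents μ φ ∧ r = (μ.variation univ).toReal}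

/-- The algebra `W₀` of Fourier transforms of Lebesgue integrable functions. -/
def W₀ : Set (ℝ → ℂ) :=
  {φ | ∃ g : ℝ → ℂ, Integrable g ∧ ∀ x : ℝ, φ x = ∫ y : ℝ, Complex.exp (Complex.I * x * y) * g y}

/-- The class `W⁺` of Fourier transforms of finite positive measures
(the positive definite functions in `W`). -/
def WPos : Set (ℝ → ℂ) :=
  {φ | ∃ μ : Measure ℝ, IsFiniteMeasure μ ∧
    ∀ x : ℝ, φ x = ∫ y : ℝ, Complex.exp (Complex.I * x * y) ∂μ}

/-- Functions of bounded variation on the circle `𝕋 = [-π, π)`: functions `F` on the line whose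
increments are `2π`-periodic, of bounded variation on bounded intervals, and with the usual
normalization at jumps, namely that `F t` lies on the segment between `F (t-)` and `F (t+)` (for
example `F` left continuous, right continuous, equal to the mean of its one-sided limits, or
monotone). -/
structure IsBVCircle (F : ℝ → ℂ) : Prop where
  locallyBV : LocallyBoundedVariationOn F univ
  periodic_increment : ∃ m : ℂ, ∀ t, F (t + 2 * π) = F t + m
  normalized : ∀ t, F t ∈ segment ℝ (Function.leftLim F t) (Function.rightLim F t)

/-- `F` on `[-2π, 2π]`, continued by constants. -/
def clamp (F : ℝ → ℂ) (t : ℝ) : ℂ := F (max (-(2 * π)) (min t (2 * π)))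

theorem IsBVCircle.boundedVariationOn_clamp {F : ℝ → ℂ} (hF : IsBVCircle F) :
    BoundedVariationOn (clamp F) univ := by
  have h0 : -(2 * π) ≤ 2 * π := by linarith [Real.pi_pos]
  have h := hF.locallyBV (-(2 * π)) (2 * π) (mem_univ _) (mem_univ _)
  refine ne_top_of_le_ne_top h ?_
  refine eVariationOn.comp_le_of_monotoneOn F (t := univ)
    (fun t : ℝ => max (-(2 * π)) (min t (2 * π))) ?_ ?_
  · intro s _ t _ hst
    exact max_le_max le_rfl (min_le_min hst le_rfl)
  · intro t _
    exact ⟨mem_univ _, le_max_left _ _, max_le h0 (min_le_right _ _)⟩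

/-- The Stieltjes measure `dF` on `𝕋 = [-π, π)`, seen as a measure on the line: it gives mass
`F (b-) - F (a-)` to `[a, b)` when `-π ≤ a ≤ b ≤ π`. -/
def dStieltjes {F : ℝ → ℂ} (hF : IsBVCircle F) : ComplexMeasure ℝ :=
  hF.boundedVariationOn_clamp.vectorMeasure.restrict (Ico (-π) π)

/-- `x ↦ ∫_𝕋 e^{-ixt} dF(t)`. -/
def phi₀ {F : ℝ → ℂ} (hF : IsBVCircle F) (x : ℝ) : ℂ :=
  (dStieltjes hF).integral (fun t : ℝ => Complex.exp (-(Complex.I * x * t)))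
    (ContinuousLinearMap.mul ℝ ℂ)

/-- `∑ c_k e^{ikt}` is the Fourier–Stieltjes series of `dF`, normalized as
`c_k = ∫_𝕋 e^{-ikt} dF(t)`. -/
def IsFourierStieltjesSeries (c : ℤ → ℂ) {F : ℝ → ℂ} (hF : IsBVCircle F) : Prop :=
  ∀ k : ℤ, c k = (dStieltjes hF).integral
    (fun t : ℝ => Complex.exp (-(Complex.I * k * t))) (ContinuousLinearMap.mul ℝ ℂ)

/-- The total variation `V(F)` of `F` over a period. -/
def totalVar (F : ℝ → ℂ) : ℝ := (eVariationOn F (Icc (-π) π)).toReal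

/-- `∑ c_k e^{ikt}` is the Fourier series of an integrable function on `𝕋`. -/
def IsFourierSeries (c : ℤ → ℂ) : Prop :=
  ∃ f : ℝ → ℂ, IntegrableOn f (Ico (-π) π) ∧
    ∀ k : ℤ, c k = (1 / (2 * π)) * ∫ t in Ico (-π) π, f t * Complex.exp (-(Complex.I * k * t))

/-- `φ` takes the value `c_k` at each integer `k`. -/
def Extends (φ : ℝ → ℂ) (c : ℤ → ℂ) : Prop := ∀ k : ℤ, φ k = c k

/-- Entire functions of exponential type at most `σ`. -/
def IsEntireOfExpType (σ : ℝ) (g : ℂ → ℂ) : Prop :=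
  Differentiable ℂ g ∧ ∀ ε > 0, ∃ C : ℝ, ∀ z : ℂ, ‖g z‖ ≤ C * Real.exp ((σ + ε) * ‖z‖)

/-- All increments of `F` are nonnegative real numbers, that is, `F` is a (weakly) increasing real
function up to an additive complex constant. -/
def IsIncreasing (F : ℝ → ℂ) : Prop :=
  ∀ s t : ℝ, s ≤ t → 0 ≤ (F t - F s).re ∧ (F t - F s).im = 0

end

end WienerSeries

/-
A complex measure `μ` on the line can be wrapped around the circle `[-π, π)`: since `e^{iky}` only
depends on `y` modulo `2π`, wrapping (and reflecting) `μ` leaves the values of its Fourier transform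
at the integers unchanged and does not increase the variation, while it preserves positivity and
absolute continuity. A measure on the circle is determined by its Fourier coefficients, so every
extension of `(c_k)` in `W` comes from a measure that wraps to `dF`, and `dF` itself, seen as a
measure on the line, gives the extension `φ₀` of least norm.

The difference of two entire extensions of exponential type `π` is bounded on the real line and
vanishes at the integers. By Phragmén–Lindelöf it is `O(e^{π |Im z|})`, so its quotient by `sin πz`
is an entire function that is bounded on `|Im z| ≥ 1` and on the lines `Re z = n + 1/2`, hence by
the maximum principle everywhere, and Liouville's theorem makes it constant.
-/

namespace WienerSeries

open Filter Topology
open scoped AddConstMap ENNReal NNReal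

section Density

variable {X E F G : Type*} [MeasurableSpace X] {m : Measure X}
  [NormedAddCommGroup E] [NormedSpace ℝ E] [NormedAddCommGroup F] [NormedSpace ℝ F]
  [NormedAddCommGroup G] [NormedSpace ℝ G]

theorem withDensityᵥ_restrict {h : X → F} (hh : Integrable h m) {s : Set X}
    (hs : MeasurableSet s) : (m.withDensityᵥ h).restrict s = (m.restrict s).withDensityᵥ h := by
  ext t ht
  rw [VectorMeasure.restrict_apply _ hs ht, withDensityᵥ_apply hh (ht.inter hs),
    withDensityᵥ_apply hh.integrableOn ht, Measure.restrict_restrict ht]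

theorem absolutelyContinuous_withDensityᵥ {h : X → F} (hh : Integrable h m) :
    m.withDensityᵥ h ≪ᵥ m.toENNRealVectorMeasure := by
  refine VectorMeasure.AbsolutelyContinuous.mk fun s hs h0 => ?_
  rw [Measure.toENNRealVectorMeasure_apply_measurable hs] at h0
  rw [withDensityᵥ_apply hh hs, setIntegral_measure_zero h h0]

theorem norm_bilin_le_norm_norm_smul (B : E →L[ℝ] F →L[ℝ] G) (x : E) (y : F) :
    ‖B x y‖ ≤ ‖B‖ * ‖‖y‖ • x‖ := by
  simpa [norm_smul, mul_assoc, mul_comm ‖x‖] using B.le_opNorm₂ x y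

variable [CompleteSpace F] {h : X → F} {f : X → E}

theorem isFiniteMeasure_variation_withDensityᵥ (hh : Integrable h m) :
    IsFiniteMeasure (m.withDensityᵥ h).variation := by
  rw [Measure.variation_withDensityᵥ hh]
  exact isFiniteMeasure_withDensity hh.2.ne

theorem integrable_norm_smul_of_integrable_variation_withDensityᵥ (hh : Integrable h m)
    (hf : Integrable f (m.withDensityᵥ h).variation) : Integrable (fun x => ‖h x‖ • f x) m := by
  rw [Measure.variation_withDensityᵥ hh] at hf
  simpa using (integrable_withDensity_iff_integrable_smul₀' hh.1.enorm (by simp)).1 hf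

theorem integral_variation_withDensityᵥ (hh : Integrable h m) (f : X → E) :
    ∫ x, f x ∂(m.withDensityᵥ h).variation = ∫ x, ‖h x‖ • f x ∂m := by
  rw [Measure.variation_withDensityᵥ hh,
    integral_withDensity_eq_integral_toReal_smul₀ hh.1.enorm (by simp)]
  simp only [toReal_enorm]

theorem integrable_bilin_of_integrable_variation_withDensityᵥ (B : E →L[ℝ] F →L[ℝ] G)
    (hh : Integrable h m) (hf : Integrable f (m.withDensityᵥ h).variation) :
    Integrable (fun x => B (f x) (h x)) m := by
  have hhf := integrable_norm_smul_of_integrable_variation_withDensityᵥ hh hf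
  -- `f` need not be measurable where `h` vanishes, so `‖h x‖` is moved onto `f`.
  have hpolar : ∀ x, B (‖h x‖ • f x) (‖h x‖⁻¹ • h x) = B (f x) (h x) := fun x => by
    rcases eq_or_ne (h x) 0 with h0 | h0
    · simp [h0]
    · simp [smul_smul, h0]
  have hmeas : AEStronglyMeasurable (fun x => B (f x) (h x)) m :=
    (B.aestronglyMeasurable_comp₂ hhf.1 (hh.1.norm.inv₀.smul hh.1)).congr
      (Eventually.of_forall hpolar)
  exact (hhf.norm.const_mul ‖B‖).mono' hmeas
    (Eventually.of_forall fun x => norm_bilin_le_norm_norm_smul B (f x) (h x))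

theorem norm_integral_bilin_le (B : E →L[ℝ] F →L[ℝ] G) (hh : Integrable h m)
    (hf : Integrable f (m.withDensityᵥ h).variation) :
    ‖∫ x, B (f x) (h x) ∂m‖ ≤ ‖B‖ * ∫ x, ‖f x‖ ∂(m.withDensityᵥ h).variation := by
  have hhf := integrable_norm_smul_of_integrable_variation_withDensityᵥ hh hf
  calc ‖∫ x, B (f x) (h x) ∂m‖ ≤ ∫ x, ‖B‖ * ‖‖h x‖ • f x‖ ∂m :=
        norm_integral_le_of_norm_le (hhf.norm.const_mul ‖B‖)
          (Eventually.of_forall fun x => norm_bilin_le_norm_norm_smul B (f x) (h x))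
    _ = ‖B‖ * ∫ x, ‖f x‖ ∂(m.withDensityᵥ h).variation := by
        simp [integral_const_mul, integral_variation_withDensityᵥ hh, norm_smul]

theorem continuous_integral_bilin (B : E →L[ℝ] F →L[ℝ] G) (hh : Integrable h m) :
    Continuous fun f : X →₁[(m.withDensityᵥ h).variation] E => ∫ x, B (f x) (h x) ∂m := by
  refine (LipschitzWith.of_dist_le_mul (K := ‖B‖₊) fun f g => ?_).continuous
  have hf := L1.integrable_coeFn f
  have hg := L1.integrable_coeFn g
  have hsub : ∀ᵐ x ∂(m.withDensityᵥ h).variation, ‖(f - g) x‖ = ‖f x - g x‖ :=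
    (Lp.coeFn_sub f g).mono fun x hx => by rw [hx, Pi.sub_apply]
  rw [dist_eq_norm, ← integral_sub (integrable_bilin_of_integrable_variation_withDensityᵥ B hh hf)
    (integrable_bilin_of_integrable_variation_withDensityᵥ B hh hg), dist_eq_norm,
    L1.norm_eq_integral_norm, integral_congr_ae hsub]
  simpa using norm_integral_bilin_le B hh (hf.sub hg)

theorem integral_withDensityᵥ [CompleteSpace G] (B : E →L[ℝ] F →L[ℝ] G) (hh : Integrable h m)
    (hf : Integrable f (m.withDensityᵥ h).variation) :
    (m.withDensityᵥ h).integral f B = ∫ x, B (f x) (h x) ∂m := by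
  have := isFiniteMeasure_variation_withDensityᵥ hh
  refine Integrable.induction (μ := (m.withDensityᵥ h).variation)
    (fun f => (m.withDensityᵥ h).integral f B = ∫ x, B (f x) (h x) ∂m) ?_ ?_
    (isClosed_eq VectorMeasure.continuous_integral (continuous_integral_bilin B hh)) ?_ hf
  · intro c s hs _
    have hind : ∀ x, B (s.indicator (fun _ => c) x) (h x) = s.indicator (fun x => B c (h x)) x :=
      fun x => by by_cases hx : x ∈ s <;> simp [hx]
    rw [VectorMeasure.integral_indicator_const _ hs, withDensityᵥ_apply hh hs,
      integral_congr_ae (Eventually.of_forall hind), integral_indicator hs,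
      (B c).integral_comp_comm hh.integrableOn]
  · intro f g _ hf hg ihf ihg
    rw [VectorMeasure.integral_add hf hg, ihf, ihg, ← integral_add
      (integrable_bilin_of_integrable_variation_withDensityᵥ B hh hf)
      (integrable_bilin_of_integrable_variation_withDensityᵥ B hh hg)]
    simp
  · intro f g hfg hf ih
    have hg := hf.congr hfg
    have hzero : ∫ x, ‖(f - g) x‖ ∂(m.withDensityᵥ h).variation = 0 :=
      integral_eq_zero_of_ae (hfg.mono fun x hx => by simp [hx])
    have hle := norm_integral_bilin_le B hh (hf.sub hg)
    rw [hzero, mul_zero, norm_le_zero_iff] at hle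
    rw [← VectorMeasure.integral_congr_ae hfg, ih, ← sub_eq_zero, ← integral_sub
      (integrable_bilin_of_integrable_variation_withDensityᵥ B hh hf)
      (integrable_bilin_of_integrable_variation_withDensityᵥ B hh hg)]
    simpa using hle

end Density

section RadonNikodym

variable {X : Type*} [MeasurableSpace X] {ν : ComplexMeasure X}

theorem withDensityᵥ_complexMeasure_rnDeriv_eq {m : Measure X} [SigmaFinite m]
    (h : ν ≪ᵥ m.toENNRealVectorMeasure) : m.withDensityᵥ (ComplexMeasure.rnDeriv ν m) = ν := by
  obtain ⟨hre, him⟩ := (ComplexMeasure.absolutelyContinuous_ennreal_iff ν _).1 h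
  have hint := ComplexMeasure.integrable_rnDeriv ν m
  ext s hs
  rw [withDensityᵥ_apply hint hs]
  refine Complex.ext ?_ ?_
  · rw [← RCLike.re_eq_complex_re, ← integral_re hint.integrableOn]
    change ∫ x in s, (ComplexMeasure.re ν).rnDeriv m x ∂m = ComplexMeasure.re ν s
    rw [← withDensityᵥ_apply (SignedMeasure.integrable_rnDeriv _ _) hs,
      SignedMeasure.withDensityᵥ_rnDeriv_eq _ _ hre]
  · rw [← RCLike.im_eq_complex_im, ← integral_im hint.integrableOn]
    change ∫ x in s, (ComplexMeasure.im ν).rnDeriv m x ∂m = ComplexMeasure.im ν s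
    rw [← withDensityᵥ_apply (SignedMeasure.integrable_rnDeriv _ _) hs,
      SignedMeasure.withDensityᵥ_rnDeriv_eq _ _ him]

theorem withDensityᵥ_rnDeriv_variation_eq [IsFiniteMeasure ν.variation] :
    ν.variation.withDensityᵥ (ComplexMeasure.rnDeriv ν ν.variation) = ν := by
  refine withDensityᵥ_complexMeasure_rnDeriv_eq
    (VectorMeasure.AbsolutelyContinuous.mk fun s hs h0 => ?_)
  rw [Measure.toENNRealVectorMeasure_apply_measurable hs] at h0
  simpa [h0] using VectorMeasure.enorm_measure_le_variation ν s

theorem integral_eq_integral_mul_rnDeriv_variation [IsFiniteMeasure ν.variation] {f : X → ℂ}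
    (hf : Integrable f ν.variation) :
    ν.integral f (ContinuousLinearMap.mul ℝ ℂ) =
      ∫ x, f x * ComplexMeasure.rnDeriv ν ν.variation x ∂ν.variation := by
  have h := integral_withDensityᵥ (ContinuousLinearMap.mul ℝ ℂ)
    (ComplexMeasure.integrable_rnDeriv ν ν.variation)
    (f := f) (by rwa [withDensityᵥ_rnDeriv_variation_eq])
  rwa [withDensityᵥ_rnDeriv_variation_eq] at h

end RadonNikodym

section Uniqueness

theorem eq_zero_of_integral_boundedContinuousFunction_eq_zero {X : Type*}
    [TopologicalSpace X] [MeasurableSpace X] [BorelSpace X] [HasOuterApproxClosed X]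
    {ν : ComplexMeasure X} [IsFiniteMeasure ν.variation]
    (h : ∀ f : BoundedContinuousFunction X ℂ,
      ν.integral f (ContinuousLinearMap.mul ℝ ℂ) = 0) : ν = 0 := by
  have hclosed : ∀ s : Set X, IsClosed s → ν s = 0 := by
    intro s hs
    let g : ℕ → BoundedContinuousFunction X ℂ := fun n =>
      .ofNormedAddCommGroup (fun x => ((hs.apprSeq n x : ℝ) : ℂ)) (by fun_prop) 1
        fun x => by simpa using HasOuterApproxClosed.apprSeq_apply_le_one hs n x
    have hlim : Tendsto (fun n => ν.integral (g n) (ContinuousLinearMap.mul ℝ ℂ)) atTop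
        (𝓝 (ν.integral (s.indicator fun _ => (1 : ℂ)) (ContinuousLinearMap.mul ℝ ℂ))) := by
      refine VectorMeasure.tendsto_integral_filter_of_norm_le_const
        (Eventually.of_forall fun n => (g n).continuous.aestronglyMeasurable)
        ⟨1, Eventually.of_forall fun n => Eventually.of_forall fun x => ?_⟩
        (Eventually.of_forall fun x => ?_)
      · simpa [g] using HasOuterApproxClosed.apprSeq_apply_le_one hs n x
      · have happr := tendsto_pi_nhds.1 (HasOuterApproxClosed.tendsto_apprSeq hs) x
        have hind :
            (((s.indicator (fun _ => 1) x : ℝ≥0) : ℝ) : ℂ) = s.indicator (fun _ => 1) x := by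
          by_cases hx : x ∈ s <;> simp [hx]
        rw [← hind]
        exact ((Complex.continuous_ofReal.comp NNReal.continuous_coe).tendsto _).comp happr
    simp only [h, VectorMeasure.integral_indicator_const _ hs.measurableSet] at hlim
    simpa using tendsto_nhds_unique hlim tendsto_const_nhds
  refine VectorMeasure.ext_of_generateFrom {s | IsClosed s}
    (fun s hs => by simpa using hclosed s hs) ?_ isPiSystem_isClosed
    (by simpa using hclosed univ isClosed_univ)
  exact BorelSpace.measurable_eq.trans borel_eq_generateFrom_isClosed

theorem eq_zero_of_integral_fourier_eq_zero {T : ℝ} [Fact (0 < T)]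
    {ν : ComplexMeasure (AddCircle T)} [IsFiniteMeasure ν.variation]
    (h : ∀ n : ℤ, ν.integral (fourier n) (ContinuousLinearMap.mul ℝ ℂ) = 0) : ν = 0 := by
  have hint (f : C(AddCircle T, ℂ)) : Integrable f ν.variation :=
    .of_bound f.continuous.aestronglyMeasurable ‖f‖ (Eventually.of_forall f.norm_coe_le_norm)
  let L : C(AddCircle T, ℂ) →ₗ[ℂ] ℂ :=
    { toFun f := ν.integral f (ContinuousLinearMap.mul ℝ ℂ)
      map_add' f g := VectorMeasure.integral_add (hint f) (hint g)
      map_smul' c f := by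
        rw [integral_eq_integral_mul_rnDeriv_variation (hint f),
          integral_eq_integral_mul_rnDeriv_variation (hint (c • f)), RingHom.id_apply,
          smul_eq_mul, ← integral_const_mul]
        simp [mul_assoc] }
  have hL : Continuous L := by
    refine (L.mkContinuous (‖ContinuousLinearMap.mul ℝ ℂ‖ * ν.variation.real univ) fun f => ?_).2
    calc ‖ν.integral f (ContinuousLinearMap.mul ℝ ℂ)‖
        ≤ ‖ContinuousLinearMap.mul ℝ ℂ‖ * ∫ x, ‖f x‖ ∂ν.variation :=
          VectorMeasure.norm_integral_le_integral_norm
      _ ≤ ‖ContinuousLinearMap.mul ℝ ℂ‖ * ∫ _, ‖f‖ ∂ν.variation := by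
          gcongr
          exacts [(hint f).norm, integrable_const _, fun x => f.norm_coe_le_norm x]
      _ = _ := by simp
  have hspan : Submodule.span ℂ (range (@fourier T)) ≤ L.ker := by
    rw [Submodule.span_le]
    rintro _ ⟨n, rfl⟩
    exact h n
  have hker : (⊤ : Submodule ℂ C(AddCircle T, ℂ)) ≤ L.ker := by
    rw [← span_fourier_closure_eq_top]
    exact Submodule.topologicalClosure_minimal _ hspan (isClosed_singleton.preimage hL)
  refine eq_zero_of_integral_boundedContinuousFunction_eq_zero fun f => ?_
  exact hker (Submodule.mem_top (x := f.toContinuousMap))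

end Uniqueness

section Intervals

theorem vectorMeasure_ext_of_generateFrom_of_iUnion {X M : Type*} [mX : MeasurableSpace X]
    [AddCommGroup M] [TopologicalSpace M] [T2Space M]
    {μ ν : VectorMeasure X M} (C : Set (Set X)) (hC : mX = MeasurableSpace.generateFrom C)
    (hpi : IsPiSystem C) {S : ℕ → Set X} (hmono : Monotone S) (hS : ∀ n, S n ∈ C)
    (hunion : ⋃ n, S n = univ) (h : ∀ s ∈ C, μ s = ν s) : μ = ν := by
  have hmeas : ∀ n, MeasurableSet (S n) := fun n => by
    rw [hC]
    exact MeasurableSpace.measurableSet_generateFrom (hS n)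
  refine VectorMeasure.ext_of_generateFrom C h hC hpi ?_
  have hμ := μ.tendsto_vectorMeasure_iUnion_atTop_nat hmono hmeas
  have hν := ν.tendsto_vectorMeasure_iUnion_atTop_nat hmono hmeas
  rw [hunion] at hμ hν
  exact tendsto_nhds_unique hμ (hν.congr fun n => (h _ (hS n)).symm)

variable {E : Type*} [NormedAddCommGroup E]

theorem vectorMeasure_ext_of_Ioc {μ ν : VectorMeasure ℝ E}
    (h : ∀ a b, a < b → μ (Ioc a b) = ν (Ioc a b)) : μ = ν := by
  refine vectorMeasure_ext_of_generateFrom_of_iUnion (S := fun n => Ioc (-(n + 1 : ℝ)) (n + 1)) _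
    (BorelSpace.measurable_eq.trans (borel_eq_generateFrom_Ioc ℝ)) (isPiSystem_Ioc id id)
    (fun m n hmn => Ioc_subset_Ioc (by gcongr) (by gcongr))
    (fun n => ⟨_, _, neg_lt_self n.cast_add_one_pos, rfl⟩) (eq_univ_of_forall fun x => ?_) ?_
  · obtain ⟨n, hn⟩ := exists_nat_gt |x|
    exact mem_iUnion.2 ⟨n, by linarith [(abs_lt.1 hn).1], by linarith [(abs_lt.1 hn).2]⟩
  · rintro _ ⟨a, b, hab, rfl⟩
    exact h a b hab

theorem vectorMeasure_ext_of_Ico {μ ν : VectorMeasure ℝ E}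
    (h : ∀ a b, a < b → μ (Ico a b) = ν (Ico a b)) : μ = ν := by
  refine vectorMeasure_ext_of_generateFrom_of_iUnion (S := fun n => Ico (-(n + 1 : ℝ)) (n + 1)) _
    (BorelSpace.measurable_eq.trans (borel_eq_generateFrom_Ico ℝ)) (isPiSystem_Ico id id)
    (fun m n hmn => Ico_subset_Ico (by gcongr) (by gcongr))
    (fun n => ⟨_, _, neg_lt_self n.cast_add_one_pos, rfl⟩) (eq_univ_of_forall fun x => ?_) ?_
  · obtain ⟨n, hn⟩ := exists_nat_gt |x|
    exact mem_iUnion.2 ⟨n, by linarith [(abs_lt.1 hn).1], by linarith [(abs_lt.1 hn).2]⟩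
  · rintro _ ⟨a, b, hab, rfl⟩
    exact h a b hab

theorem iUnion_Ico_eq_of_tendsto {α : Type*} [TopologicalSpace α] [LinearOrder α]
    [OrderTopology α] {a t : α} {u : ℕ → α} (hlt : ∀ n, u n < t) (hu : Tendsto u atTop (𝓝 t)) :
    ⋃ n, Ico a (u n) = Ico a t := by
  refine (iUnion_subset fun n => Ico_subset_Ico_right (hlt n).le).antisymm fun x hx => ?_
  obtain ⟨n, hn⟩ := (hu.eventually (lt_mem_nhds hx.2)).exists
  exact mem_iUnion.2 ⟨n, hx.1, hn⟩

theorem tendsto_vectorMeasure_Ico_of_monotone (ν : VectorMeasure ℝ E) {a t : ℝ} {u : ℕ → ℝ}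
    (hmono : Monotone u) (hlt : ∀ n, u n < t) (hu : Tendsto u atTop (𝓝 t)) :
    Tendsto (fun n => ν (Ico a (u n))) atTop (𝓝 (ν (Ico a t))) := by
  rw [← iUnion_Ico_eq_of_tendsto hlt hu]
  exact ν.tendsto_vectorMeasure_iUnion_atTop_nat
    (fun m n hmn => Ico_subset_Ico_right (hmono hmn)) fun n => measurableSet_Ico

theorem measure_Ico_le_of_forall_lt {m : Measure ℝ} {a t : ℝ} {c : ℝ≥0∞}
    (h : ∀ b < t, m (Ico a b) ≤ c) : m (Ico a t) ≤ c := by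
  obtain ⟨u, hmono, hlt, hu⟩ := exists_seq_strictMono_tendsto t
  rw [← iUnion_Ico_eq_of_tendsto hlt hu, Monotone.measure_iUnion fun i j hij =>
    Ico_subset_Ico_right (hmono.monotone hij)]
  exact iSup_le fun n => h _ (hlt n)

end Intervals

section Variation

variable {E : Type*} [NormedAddCommGroup E] [CompleteSpace E] {f : ℝ → E}

theorem isFiniteMeasure_stieltjesFunctionRightLim (hf : BoundedVariationOn f univ) :
    IsFiniteMeasure (hf.stieltjesFunctionRightLim 0).measure :=
  StieltjesFunction.isFiniteMeasure_of_forall_abs_le _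
    fun _ => variationOnFromTo.abs_le_eVariationOn hf.rightLim

theorem stieltjesFunctionRightLim_measure_Ioc (hf : BoundedVariationOn f univ) {u v : ℝ}
    (huv : u ≤ v) :
    (hf.stieltjesFunctionRightLim 0).measure (Ioc u v) =
      eVariationOn (Function.rightLim f) (Icc u v) := by
  rw [StieltjesFunction.measure_Ioc, BoundedVariationOn.stieltjesFunctionRightLim_apply,
    BoundedVariationOn.stieltjesFunctionRightLim_apply,
    variationOnFromTo.sub_right hf.rightLim.locallyBoundedVariationOn
      (mem_univ 0) (mem_univ v) (mem_univ u), variationOnFromTo.eq_of_le _ _ huv, univ_inter,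
    ENNReal.ofReal_toReal (hf.rightLim.mono (subset_univ _))]

theorem variation_vectorMeasure_le (hf : BoundedVariationOn f univ)
    {m : Measure ℝ} [IsFiniteMeasure m]
    (h : ∀ u v, u ≤ v → ‖Function.rightLim f v - Function.rightLim f u‖ₑ ≤ m (Ioc u v)) :
    hf.vectorMeasure.variation ≤ m := by
  obtain ⟨ν, hν, hle⟩ :=
    VectorMeasure.exists_extension_of_isSetSemiring_of_le_measure_of_generateFrom (μ := m)
      (m := AddContent.onIoc (Function.rightLim f)) IsSetSemiring.Ioc (by
        rintro _ ⟨u, v, huv, rfl⟩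
        simpa only [AddContent.onIoc_apply huv] using h u v huv)
      (by
        refine BorelSpace.measurable_eq.trans ?_
        convert! borel_eq_generateFrom_Ioc_le ℝ using 2
        grind only)
  have hext : ν = hf.vectorMeasure := vectorMeasure_ext_of_Ioc fun u v huv => by
    rw [hν _ ⟨u, v, huv.le, rfl⟩, AddContent.onIoc_apply huv.le, hf.vectorMeasure_Ioc huv.le]
  exact VectorMeasure.variation_le_of_forall_enorm_le fun s _ => hext ▸ hle s

theorem variation_vectorMeasure_le_measure (hf : BoundedVariationOn f univ) :
    hf.vectorMeasure.variation ≤ (hf.stieltjesFunctionRightLim 0).measure :=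
  have := isFiniteMeasure_stieltjesFunctionRightLim hf
  variation_vectorMeasure_le hf fun u v huv => by
    rw [stieltjesFunctionRightLim_measure_Ioc hf huv, ← edist_eq_enorm_sub]
    exact eVariationOn.edist_le _ ⟨huv, le_rfl⟩ ⟨le_rfl, huv⟩

theorem isFiniteMeasure_variation_vectorMeasure (hf : BoundedVariationOn f univ) :
    IsFiniteMeasure hf.vectorMeasure.variation :=
  have := isFiniteMeasure_stieltjesFunctionRightLim hf
  isFiniteMeasure_of_le _ (variation_vectorMeasure_le_measure hf)

theorem variation_vectorMeasure_Ico_le (hf : BoundedVariationOn f univ) {a' a b b' : ℝ}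
    (ha : a' < a) (hab : a ≤ b) (hb : b < b') :
    hf.vectorMeasure.variation (Ico a b) ≤ eVariationOn f (Ioo a' b') := by
  obtain ⟨u, ha'u, hua⟩ := exists_between ha
  calc hf.vectorMeasure.variation (Ico a b)
      ≤ (hf.stieltjesFunctionRightLim 0).measure (Ioc u b) :=
        (variation_vectorMeasure_le_measure hf _).trans
          (measure_mono fun x hx => ⟨hua.trans_le hx.1, hx.2.le⟩)
    _ = eVariationOn (Function.rightLim f) (Icc u b) :=
        stieltjesFunctionRightLim_measure_Ioc hf (hua.le.trans hab)
    _ ≤ eVariationOn (Function.rightLim f) (Ioo a' b') :=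
        eVariationOn.mono _ (Icc_subset_Ioo ha'u hb)
    _ ≤ eVariationOn f (Ioo a' b') := eVariationOn.eVariationOn_rightLim_le isOpen_Ioo

end Variation

section PeriodicIncrements

variable {E : Type*}

theorem eVariationOn_le_of_dist_le {α : Type*} [LinearOrder α] [PseudoMetricSpace E] {f : α → E}
    {g : α → ℝ} {s : Set α} (h : ∀ x ∈ s, ∀ y ∈ s, x ≤ y → dist (f x) (f y) ≤ g y - g x) :
    eVariationOn f s ≤ eVariationOn g s := by
  refine iSup_le fun p => (Finset.sum_le_sum fun i _ => ?_).trans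
    (eVariationOn.sum_le (f := g) p.2.2.1 p.2.2.2)
  rw [edist_comm, edist_dist, edist_dist, Real.dist_eq]
  exact ENNReal.ofReal_le_ofReal
    ((h _ (p.2.2.2 i) _ (p.2.2.2 (i + 1)) (p.2.2.1 i.le_succ)).trans (le_abs_self _))

theorem eVariationOn_Icc_add_period [SeminormedAddCommGroup E] {f : ℝ → E} {p : ℝ} {m : E}
    (hf : ∀ t, f (t + p) = f t + m) (a b : ℝ) :
    eVariationOn f (Icc (a + p) (b + p)) = eVariationOn f (Icc a b) := by
  rw [← image_add_const_Icc, ← eVariationOn.comp_eq_of_monotoneOn f (· + p)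
    (add_left_mono.monotoneOn _)]
  simp only [eVariationOn, Function.comp_apply, hf, edist_add_right]

theorem eVariationOn_Icc_self_add_period [SeminormedAddCommGroup E] {f : ℝ → E} {p : ℝ} {m : E}
    (hf : ∀ t, f (t + p) = f t + m) {a b : ℝ} (hab : a ≤ b) (hba : b ≤ a + p) :
    eVariationOn f (Icc a (a + p)) = eVariationOn f (Icc b (b + p)) := by
  have h₁ := eVariationOn.Icc_add_Icc f (s := univ) hab hba (mem_univ _)
  have h₂ := eVariationOn.Icc_add_Icc f (s := univ) hba (add_le_add_left hab p) (mem_univ _)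
  simp only [univ_inter] at h₁ h₂
  rw [← h₁, ← h₂, eVariationOn_Icc_add_period hf, add_comm]

theorem leftLim_add_period [AddGroup E] [TopologicalSpace E] [ContinuousAdd E] [T2Space E]
    {f : ℝ → E} {p : ℝ} {m : E} (hf : ∀ t, f (t + p) = f t + m) {t : ℝ}
    (ht : Tendsto f (𝓝[<] t) (𝓝 (Function.leftLim f t))) :
    Function.leftLim f (t + p) = Function.leftLim f t + m := by
  refine leftLim_eq_of_tendsto ?_
  have hsub : Tendsto (· - p) (𝓝[<] (t + p)) (𝓝[<] t) := by
    exact le_of_eq (by simp [sub_eq_add_neg])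
  refine ((ht.comp hsub).add_const m).congr fun x => ?_
  rw [Function.comp_apply, ← hf, sub_add_cancel]

end PeriodicIncrements

section OneSidedLimits

variable {E : Type*} [PseudoMetricSpace E] [CompleteSpace E] {f : ℝ → E}

theorem tendsto_leftLim_of_locallyBoundedVariationOn (hf : LocallyBoundedVariationOn f univ)
    (t : ℝ) : Tendsto f (𝓝[<] t) (𝓝 (Function.leftLim f t)) := by
  obtain ⟨l, hl⟩ :=
    BoundedVariationOn.exists_tendsto_left (hf (t - 1) t (mem_univ _) (mem_univ _)) t
  refine tendsto_leftLim_of_tendsto ⟨l, hl.mono_left ?_⟩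
  rw [univ_inter]
  refine nhdsWithin_le_of_mem (mem_of_superset (Ico_mem_nhdsLT (sub_one_lt t)) fun x hx => ?_)
  exact ⟨⟨hx.1, hx.2.le⟩, hx.2⟩

theorem tendsto_rightLim_of_locallyBoundedVariationOn (hf : LocallyBoundedVariationOn f univ)
    (t : ℝ) : Tendsto f (𝓝[>] t) (𝓝 (Function.rightLim f t)) := by
  obtain ⟨l, hl⟩ :=
    BoundedVariationOn.exists_tendsto_right (hf t (t + 1) (mem_univ _) (mem_univ _)) t
  refine tendsto_rightLim_of_tendsto ⟨l, hl.mono_left ?_⟩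
  rw [univ_inter]
  refine nhdsWithin_le_of_mem (mem_of_superset (Ioc_mem_nhdsGT (lt_add_one t)) fun x hx => ?_)
  exact ⟨⟨hx.1.le, hx.2⟩, hx.1⟩

end OneSidedLimits

section Clamp

variable {F : ℝ → ℂ}

theorem IsBVCircle.tendsto_leftLim (hF : IsBVCircle F) (t : ℝ) :
    Tendsto F (𝓝[<] t) (𝓝 (Function.leftLim F t)) :=
  tendsto_leftLim_of_locallyBoundedVariationOn hF.locallyBV t

theorem IsBVCircle.tendsto_rightLim (hF : IsBVCircle F) (t : ℝ) :
    Tendsto F (𝓝[>] t) (𝓝 (Function.rightLim F t)) :=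
  tendsto_rightLim_of_locallyBoundedVariationOn hF.locallyBV t

theorem clamp_eqOn_Icc (F : ℝ → ℂ) : EqOn (clamp F) F (Icc (-(2 * π)) (2 * π)) := fun t ht => by
  rw [clamp, min_eq_left ht.2, max_eq_right ht.1]

theorem eventuallyEq_clamp (F : ℝ → ℂ) {t : ℝ} (ht : t ∈ Icc (-π) π) : F =ᶠ[𝓝 t] clamp F := by
  refine mem_of_superset (Icc_mem_nhds ?_ ?_) fun x hx => (clamp_eqOn_Icc F hx).symm <;>
    linarith [Real.pi_pos, ht.1, ht.2]

theorem leftLim_clamp (hF : IsBVCircle F) {t : ℝ} (ht : t ∈ Icc (-π) π) :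
    Function.leftLim (clamp F) t = Function.leftLim F t :=
  leftLim_eq_of_tendsto
    ((hF.tendsto_leftLim t).congr' (nhdsWithin_le_nhds (eventuallyEq_clamp F ht)))

theorem rightLim_clamp (hF : IsBVCircle F) {t : ℝ} (ht : t ∈ Icc (-π) π) :
    Function.rightLim (clamp F) t = Function.rightLim F t :=
  rightLim_eq_of_tendsto
    ((hF.tendsto_rightLim t).congr' (nhdsWithin_le_nhds (eventuallyEq_clamp F ht)))

end Clamp

section StieltjesMeasure

theorem neg_pi_add_two_pi : -π + 2 * π = π := by ring

variable {F : ℝ → ℂ} (hF : IsBVCircle F)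
include hF

theorem dStieltjes_restrict : (dStieltjes hF).restrict (Ico (-π) π) = dStieltjes hF := by
  ext s hs
  rw [dStieltjes, VectorMeasure.restrict_apply _ measurableSet_Ico hs,
    VectorMeasure.restrict_apply _ measurableSet_Ico (hs.inter measurableSet_Ico),
    VectorMeasure.restrict_apply _ measurableSet_Ico hs, inter_assoc, inter_self]

theorem dStieltjes_apply {s : Set ℝ} (hs : MeasurableSet s) (hsub : s ⊆ Ico (-π) π) :
    dStieltjes hF s = hF.boundedVariationOn_clamp.vectorMeasure s := by
  rw [dStieltjes, VectorMeasure.restrict_apply _ measurableSet_Ico hs, inter_eq_left.2 hsub]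

theorem dStieltjes_Ico {a b : ℝ} (ha : -π ≤ a) (hab : a ≤ b) (hb : b ≤ π) :
    dStieltjes hF (Ico a b) = Function.leftLim F b - Function.leftLim F a := by
  rw [dStieltjes_apply hF measurableSet_Ico (Ico_subset_Ico ha hb),
    BoundedVariationOn.vectorMeasure_Ico _ hab, leftLim_clamp hF ⟨ha.trans hab, hb⟩,
    leftLim_clamp hF ⟨ha, hab.trans hb⟩]

theorem dStieltjes_Ioo {a b : ℝ} (ha : -π ≤ a) (hab : a < b) (hb : b ≤ π) :
    dStieltjes hF (Ioo a b) = Function.leftLim F b - Function.rightLim F a := by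
  rw [dStieltjes_apply hF measurableSet_Ioo fun x hx => ⟨ha.trans hx.1.le, hx.2.trans_le hb⟩,
    BoundedVariationOn.vectorMeasure_Ioo _ hab, leftLim_clamp hF ⟨ha.trans hab.le, hb⟩,
    rightLim_clamp hF ⟨ha, hab.le.trans hb⟩]

theorem dStieltjes_singleton {a : ℝ} (ha : -π ≤ a) (hb : a < π) :
    dStieltjes hF {a} = Function.rightLim F a - Function.leftLim F a := by
  rw [dStieltjes_apply hF (measurableSet_singleton a) (singleton_subset_iff.2 ⟨ha, hb⟩),
    BoundedVariationOn.vectorMeasure_singleton, leftLim_clamp hF ⟨ha, hb.le⟩,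
    rightLim_clamp hF ⟨ha, hb.le⟩]

instance isFiniteMeasure_variation_dStieltjes : IsFiniteMeasure (dStieltjes hF).variation :=
  have := isFiniteMeasure_variation_vectorMeasure hF.boundedVariationOn_clamp
  isFiniteMeasure_of_le _ VectorMeasure.variation_restrict_le

theorem norm_sub_leftLim_add_norm_rightLim_sub (t : ℝ) :
    ‖F t - Function.leftLim F t‖ + ‖Function.rightLim F t - F t‖ =
      ‖Function.rightLim F t - Function.leftLim F t‖ := by
  simpa only [dist_eq_norm, norm_sub_rev] using dist_add_dist_of_mem_segment (hF.normalized t)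

theorem dist_add_variation_Ico_le {x y : ℝ} (hx : -π ≤ x) (hxy : x < y) (hy : y ≤ π) :
    dist (F x) (F y) + ((dStieltjes hF).variation.real (Ico (-π) x) + ‖F x - Function.leftLim F x‖)
      ≤ (dStieltjes hF).variation.real (Ico (-π) y) + ‖F y - Function.leftLim F y‖ := by
  have hsplit : (dStieltjes hF).variation.real (Ico (-π) y) =
      (dStieltjes hF).variation.real (Ico (-π) x) + ((dStieltjes hF).variation.real {x} +
        (dStieltjes hF).variation.real (Ioo x y)) := by
    rw [← Ico_union_Ico_eq_Ico hx hxy.le,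
      measureReal_union (Ico_disjoint_Ico_same) measurableSet_Ico,
      ← Ioo_union_left hxy, union_comm, measureReal_union (by simp) measurableSet_Ioo]
  have hjump : ‖F x - Function.leftLim F x‖ + ‖Function.rightLim F x - F x‖ ≤
      (dStieltjes hF).variation.real {x} := by
    rw [norm_sub_leftLim_add_norm_rightLim_sub hF,
      ← dStieltjes_singleton hF hx (hxy.trans_le hy)]
    exact VectorMeasure.norm_measure_le_variation
  have hopen : ‖Function.leftLim F y - Function.rightLim F x‖ ≤
      (dStieltjes hF).variation.real (Ioo x y) := by
    rw [← dStieltjes_Ioo hF hx hxy hy]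
    exact VectorMeasure.norm_measure_le_variation
  have htri : dist (F x) (F y) ≤ ‖F y - Function.leftLim F y‖ +
      ‖Function.leftLim F y - Function.rightLim F x‖ + ‖Function.rightLim F x - F x‖ := by
    simpa only [dist_comm (F x), dist_eq_norm, sub_add_sub_cancel] using
      norm_add₃_le (a := F y - Function.leftLim F y)
        (b := Function.leftLim F y - Function.rightLim F x) (c := Function.rightLim F x - F x)
  linarith

theorem pi_sub_leftLim_pi :
    F π - Function.leftLim F π = F (-π) - Function.leftLim F (-π) := by
  obtain ⟨m, hm⟩ := hF.periodic_increment
  rw [← neg_pi_add_two_pi, hm, leftLim_add_period hm (hF.tendsto_leftLim _), neg_pi_add_two_pi,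
    add_sub_add_right_eq_sub]

theorem eVariationOn_le_variation_dStieltjes :
    eVariationOn F (Icc (-π) π) ≤ (dStieltjes hF).variation univ := by
  set G : ℝ → ℝ := fun t =>
    (dStieltjes hF).variation.real (Ico (-π) t) + ‖F t - Function.leftLim F t‖ with hG
  have hdist : ∀ x ∈ Icc (-π) π, ∀ y ∈ Icc (-π) π, x ≤ y → dist (F x) (F y) ≤ G y - G x := by
    intro x hx y hy hxy
    rcases hxy.eq_or_lt with rfl | hlt
    · simp only [dist_self, sub_self, le_refl]
    · exact le_sub_iff_add_le.2 (dist_add_variation_Ico_le hF hx.1 hlt hy.2)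
  have hmono : MonotoneOn G (Icc (-π) π) := fun x hx y hy hxy =>
    sub_nonneg.1 (dist_nonneg.trans (hdist x hx y hy hxy))
  have hle : -π ≤ π := neg_le_self Real.pi_nonneg
  calc eVariationOn F (Icc (-π) π)
      ≤ eVariationOn G (Icc (-π) π) := eVariationOn_le_of_dist_le hdist
    _ = ENNReal.ofReal (G π - G (-π)) := by
        simpa only [inter_self] using hmono.eVariationOn_eq ⟨le_rfl, hle⟩ ⟨hle, le_rfl⟩
    _ = (dStieltjes hF).variation (Ico (-π) π) := by
        simp only [hG, pi_sub_leftLim_pi hF, Ico_self, measureReal_empty, zero_add,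
          add_sub_cancel_right]
        exact ofReal_measureReal
    _ ≤ (dStieltjes hF).variation univ := measure_mono (subset_univ _)

theorem variation_dStieltjes_Ico_le {b : ℝ} (hb : b < π) :
    (dStieltjes hF).variation (Ico (-π) b) ≤ eVariationOn F (Icc (-π) π) := by
  rcases lt_or_ge b (-π) with hbπ | hbπ
  · simp [Ico_eq_empty hbπ.not_gt]
  obtain ⟨b', hbb', hb'⟩ := exists_between (max_lt hb Real.pi_pos)
  have hb'0 := (le_max_right b 0).trans_lt hbb'
  obtain ⟨m, hm⟩ := hF.periodic_increment
  calc (dStieltjes hF).variation (Ico (-π) b)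
      ≤ hF.boundedVariationOn_clamp.vectorMeasure.variation (Ico (-π) b) :=
        (VectorMeasure.variation_restrict_le _).trans (Measure.restrict_apply_le _ _)
    _ ≤ eVariationOn (clamp F) (Ioo (b' - 2 * π) b') :=
        variation_vectorMeasure_Ico_le _ (by linarith) hbπ ((le_max_left b 0).trans_lt hbb')
    _ = eVariationOn F (Ioo (b' - 2 * π) b') := by
        refine eVariationOn.congr fun x hx => clamp_eqOn_Icc F ⟨?_, ?_⟩ <;>
          linarith [hx.1, hx.2]
    _ ≤ eVariationOn F (Icc (b' - 2 * π) (b' - 2 * π + 2 * π)) :=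
        eVariationOn.mono _ fun x hx => ⟨hx.1.le, by linarith [hx.2]⟩
    _ = eVariationOn F (Icc (-π) (-π + 2 * π)) :=
        eVariationOn_Icc_self_add_period hm (by linarith) (by linarith)
    _ = eVariationOn F (Icc (-π) π) := by rw [neg_add_eq_sub, two_mul, add_sub_cancel_right]

theorem variation_dStieltjes_univ :
    (dStieltjes hF).variation univ = eVariationOn F (Icc (-π) π) := by
  refine le_antisymm ?_ (eVariationOn_le_variation_dStieltjes hF)
  rw [← dStieltjes_restrict hF, VectorMeasure.variation_restrict measurableSet_Ico,
    Measure.restrict_apply_univ]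
  exact measure_Ico_le_of_forall_lt fun b hb => variation_dStieltjes_Ico_le hF hb

theorem totalVar_eq_variation : totalVar F = ((dStieltjes hF).variation univ).toReal := by
  rw [totalVar, variation_dStieltjes_univ hF]

end StieltjesMeasure

section Primitive

/-- The function that agrees with `f` on `(a, a + p]` and increases by `m` over each period `p`. -/
noncomputable def extendByPeriod {E : Type*} [AddCommGroup E] {p : ℝ} (hp : 0 < p) (a : ℝ)
    (f : ℝ → E) (m : E) : ℝ →+c[p, m] E where
  toFun t := f (toIocMod hp a t) + toIocDiv hp a t • m
  map_add_const' t := by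
    rw [toIocMod_add_right, toIocDiv_add_right, add_zsmul, one_zsmul, add_assoc]

theorem extendByPeriod_apply_of_mem_Icc {E : Type*} [AddCommGroup E] {p : ℝ} (hp : 0 < p) {a : ℝ}
    {f : ℝ → E} (ha : f a = 0) {t : ℝ} (ht : t ∈ Icc a (a + p)) :
    extendByPeriod hp a f (f (a + p)) t = f t := by
  have hIoc : ∀ s ∈ Ioc a (a + p), extendByPeriod hp a f (f (a + p)) s = f s := fun s hs => by
    change f (toIocMod hp a s) + toIocDiv hp a s • f (a + p) = f s
    rw [(toIocMod_eq_self hp).2 hs,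
      toIocDiv_eq_of_sub_zsmul_mem_Ioc hp (n := 0) (by simpa using hs), zero_zsmul, add_zero]
  rcases ht.1.eq_or_lt with rfl | hlt
  · have h := AddConstMapClass.map_add_const (extendByPeriod hp a f (f (a + p))) a
    rw [hIoc _ (right_mem_Ioc.2 (lt_add_of_pos_right a hp))] at h
    rw [ha, ← right_eq_add.1 h]
  · exact hIoc t ⟨hlt, ht.2⟩

theorem locallyBoundedVariationOn_of_dist_le {α E : Type*} [LinearOrder α] [PseudoMetricSpace E]
    {f : α → E} {g : α → ℝ} {s : Set α}
    (h : ∀ x ∈ s, ∀ y ∈ s, x ≤ y → dist (f x) (f y) ≤ g y - g x) :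
    LocallyBoundedVariationOn f s := by
  have hg : MonotoneOn g s := fun x hx y hy hxy =>
    sub_nonneg.1 (dist_nonneg.trans (h x hx y hy hxy))
  exact fun a b ha hb => ne_top_of_le_ne_top (hg.locallyBoundedVariationOn a b ha hb)
    (eVariationOn_le_of_dist_le fun x hx y hy => h x hx.1 y hy.1)

theorem dist_le_sub_of_Icc {E : Type*} [SeminormedAddCommGroup E] {p M : ℝ} {m : E} (hp : 0 < p)
    (f : ℝ →+c[p, m] E) (g : ℝ →+c[p, M] ℝ) {a : ℝ}
    (h : ∀ x ∈ Icc a (a + p), ∀ y ∈ Icc a (a + p), x < y → dist (f x) (f y) ≤ g y - g x)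
    {x y : ℝ} (hxy : x ≤ y) : dist (f x) (f y) ≤ g y - g x := by
  let R : E × ℝ → E × ℝ → Prop := fun u v => dist u.1 v.1 ≤ v.2 - u.2
  have : IsTrans (E × ℝ) R := ⟨fun u v w huv hvw =>
    (dist_triangle u.1 v.1 w.1).trans ((add_le_add huv hvw).trans_eq (by ring))⟩
  have : CovariantClass (E × ℝ) (E × ℝ) (fun u v => v + u) R := ⟨fun w u v huv => by
    simpa only [R, Prod.fst_add, Prod.snd_add, dist_add_right, add_sub_add_right_eq_sub] using huv⟩
  let fg : ℝ →+c[p, (m, M)] E × ℝ :=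
    ⟨fun t => (f t, g t), fun t => by
      rw [AddConstMapClass.map_add_const, AddConstMapClass.map_add_const, Prod.mk_add_mk]⟩
  rcases hxy.eq_or_lt with rfl | hlt
  · simp only [dist_self, sub_self, le_refl]
  · exact AddConstMapClass.rel_map_of_Icc (f := fg) (R := R) hp h hlt

/-- The distribution function `t ↦ ν [-π, t)` of a measure on `[-π, π)`, extended to the line with
constant increments over the periods; it is the left-continuous `F` with `dF = ν`. -/
noncomputable def primitive {E : Type*} [AddCommGroup E] [TopologicalSpace E]
    (ν : VectorMeasure ℝ E) : ℝ →+c[2 * π, ν (Ico (-π) (-π + 2 * π))] E :=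
  extendByPeriod two_pi_pos (-π) (fun t => ν (Ico (-π) t)) _

theorem primitive_apply {E : Type*} [AddCommGroup E] [TopologicalSpace E] (ν : VectorMeasure ℝ E)
    {t : ℝ} (ht : t ∈ Icc (-π) π) : primitive ν t = ν (Ico (-π) t) :=
  extendByPeriod_apply_of_mem_Icc two_pi_pos (f := fun t => ν (Ico (-π) t))
    (by rw [Ico_self, VectorMeasure.empty]) (by rwa [neg_pi_add_two_pi])

theorem primitive_sub_primitive {E : Type*} [AddCommGroup E] [TopologicalSpace E] [T2Space E]
    (ν : VectorMeasure ℝ E) {s t : ℝ} (hs : -π ≤ s) (hst : s ≤ t) (ht : t ≤ π) :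
    primitive ν t - primitive ν s = ν (Ico s t) := by
  rw [primitive_apply ν ⟨hs, hst.trans ht⟩, primitive_apply ν ⟨hs.trans hst, ht⟩,
    ← Ico_union_Ico_eq_Ico hs hst, VectorMeasure.of_union Ico_disjoint_Ico_same measurableSet_Ico
      measurableSet_Ico, add_sub_cancel_left]

variable {E : Type*} [NormedAddCommGroup E]

theorem dist_primitive_le (ν : VectorMeasure ℝ E) [IsFiniteMeasure ν.variation] {s t : ℝ}
    (hst : s ≤ t) :
    dist (primitive ν s) (primitive ν t) ≤
      primitive ν.variation.toSignedMeasure t - primitive ν.variation.toSignedMeasure s := by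
  refine dist_le_sub_of_Icc two_pi_pos _ _ (fun x hx y hy hxy => ?_) hst (a := -π)
  rw [neg_pi_add_two_pi] at hx hy
  rw [dist_comm, dist_eq_norm, primitive_sub_primitive _ hx.1 hxy.le hy.2,
    primitive_sub_primitive _ hx.1 hxy.le hy.2,
    Measure.toSignedMeasure_apply_measurable measurableSet_Ico]
  exact VectorMeasure.norm_measure_le_variation

theorem locallyBoundedVariationOn_primitive (ν : VectorMeasure ℝ E)
    [IsFiniteMeasure ν.variation] : LocallyBoundedVariationOn (primitive ν) univ :=
  locallyBoundedVariationOn_of_dist_le fun _ _ _ _ => dist_primitive_le ν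

theorem leftLim_primitive [CompleteSpace E] (ν : VectorMeasure ℝ E) [IsFiniteMeasure ν.variation]
    (t : ℝ) : Function.leftLim (primitive ν) t = primitive ν t := by
  have htendsto := tendsto_leftLim_of_locallyBoundedVariationOn
    (locallyBoundedVariationOn_primitive ν)
  have hper : Function.Periodic (fun t => Function.leftLim (primitive ν) t - primitive ν t)
      (2 * π) := fun t => by
    simp only [leftLim_add_period (AddConstMapClass.map_add_const (primitive ν)) (htendsto t),
      AddConstMapClass.map_add_const, add_sub_add_right_eq_sub]
  obtain ⟨s, hs, hts⟩ := hper.exists_mem_Ioc two_pi_pos t (-π)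
  rw [neg_pi_add_two_pi] at hs
  refine sub_eq_zero.1 (hts.trans (sub_eq_zero.2 ?_))
  obtain ⟨u, hmono, hmem, hu⟩ := exists_seq_strictMono_tendsto' hs.1
  have hprim : Tendsto (fun n => primitive ν (u n)) atTop (𝓝 (primitive ν s)) := by
    rw [primitive_apply ν ⟨hs.1.le, hs.2⟩]
    exact (tendsto_vectorMeasure_Ico_of_monotone ν hmono.monotone (fun n => (hmem n).2) hu).congr
      fun n => (primitive_apply ν ⟨(hmem n).1.le, (hmem n).2.le.trans hs.2⟩).symm
  exact tendsto_nhds_unique ((htendsto s).comp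
    (tendsto_nhdsWithin_iff.2 ⟨hu, Eventually.of_forall fun n => (hmem n).2⟩)) hprim

theorem isBVCircle_primitive (ν : ComplexMeasure ℝ) [IsFiniteMeasure ν.variation] :
    IsBVCircle (primitive ν) where
  locallyBV := locallyBoundedVariationOn_primitive ν
  periodic_increment := ⟨_, AddConstMapClass.map_add_const _⟩
  normalized t := by
    rw [leftLim_primitive]
    exact left_mem_segment ℝ _ _

theorem vectorMeasure_ext_of_Ico_of_restrict {μ ν : VectorMeasure ℝ E} {a b : ℝ}
    (hμ : μ.restrict (Ico a b) = μ) (hν : ν.restrict (Ico a b) = ν)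
    (h : ∀ s t, a ≤ s → s ≤ t → t ≤ b → μ (Ico s t) = ν (Ico s t)) : μ = ν := by
  refine vectorMeasure_ext_of_Ico fun s t _ => ?_
  rw [← hμ, ← hν, VectorMeasure.restrict_apply _ measurableSet_Ico measurableSet_Ico,
    VectorMeasure.restrict_apply _ measurableSet_Ico measurableSet_Ico, Ico_inter_Ico]
  rcases le_total (s ⊔ a) (t ⊓ b) with hle | hle
  · exact h _ _ le_sup_right hle inf_le_right
  · rw [Ico_eq_empty hle.not_gt, VectorMeasure.empty, VectorMeasure.empty]

theorem dStieltjes_primitive (ν : ComplexMeasure ℝ) [IsFiniteMeasure ν.variation]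
    (hν : ν.restrict (Ico (-π) π) = ν) : dStieltjes (isBVCircle_primitive ν) = ν :=
  vectorMeasure_ext_of_Ico_of_restrict (dStieltjes_restrict _) hν fun s t hs hst ht => by
    rw [dStieltjes_Ico _ hs hst ht, leftLim_primitive, leftLim_primitive,
      primitive_sub_primitive _ hs hst ht]

end Primitive

section Monotone

open scoped ComplexOrder

theorem isIncreasing_iff_monotone {F : ℝ → ℂ} : IsIncreasing F ↔ Monotone F :=
  forall₃_congr fun s t _ => by
    rw [Complex.le_def, Complex.sub_re, Complex.sub_im, sub_nonneg, sub_eq_zero,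
      eq_comm (a := (F t).im)]

theorem eVariationOn_le_of_monotoneOn {α : Type*} [LinearOrder α] {f : α → ℂ} {a b : α}
    (hab : a ≤ b) (hf : MonotoneOn f (Icc a b)) :
    eVariationOn f (Icc a b) ≤ ENNReal.ofReal (f b - f a).re := by
  have hre : MonotoneOn (fun x => (f x).re) (Icc a b) := fun x hx y hy hxy =>
    (Complex.le_def.1 (hf hx hy hxy)).1
  calc eVariationOn f (Icc a b) ≤ eVariationOn (fun x => (f x).re) (Icc a b) :=
        eVariationOn_le_of_dist_le fun x hx y hy hxy => by
          rw [dist_comm, dist_eq_norm, ← Complex.sub_re,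
            Complex.re_eq_norm.2 (sub_nonneg.2 (hf hx hy hxy))]
    _ = ENNReal.ofReal (f b - f a).re := by
        simpa only [inter_self, Complex.sub_re] using
          hre.eVariationOn_eq (left_mem_Icc.2 hab) (right_mem_Icc.2 hab)

theorem vectorMeasure_eq_variation_of_univ {X : Type*} [MeasurableSpace X] {ν : ComplexMeasure X}
    [IsFiniteMeasure ν.variation] (h : ν.variation.real univ ≤ (ν univ).re) :
    ν.variation.withDensityᵥ (fun _ => (1 : ℂ)) = ν := by
  ext s hs
  have hle : ∀ t, (ν t).re ≤ ν.variation.real t := fun t =>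
    (Complex.re_le_norm _).trans VectorMeasure.norm_measure_le_variation
  have hsum : ν univ = ν s + ν sᶜ := by
    rw [← VectorMeasure.of_union disjoint_compl_right hs hs.compl, union_compl_self]
  have hre : (ν s).re = ν.variation.real s := by
    refine le_antisymm (hle s) ?_
    rw [hsum, ← measureReal_add_measureReal_compl hs, Complex.add_re] at h
    linarith [hle sᶜ]
  have hnorm : (ν s).re = ‖ν s‖ := le_antisymm (Complex.re_le_norm _)
    (hre ▸ VectorMeasure.norm_measure_le_variation)
  rw [withDensityᵥ_apply (integrable_const _) hs, setIntegral_const, ← hre, Complex.real_smul,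
    mul_one, ← Complex.eq_re_of_ofReal_le (r := 0) (by simpa using Complex.re_eq_norm.1 hnorm)]

variable {F : ℝ → ℂ} (hF : IsBVCircle F)
include hF

theorem dStieltjes_univ : dStieltjes hF univ = F π - F (-π) := by
  have h : F π - F (-π) = Function.leftLim F π - Function.leftLim F (-π) := by
    linear_combination pi_sub_leftLim_pi hF
  rw [h, ← dStieltjes_Ico hF le_rfl (neg_le_self Real.pi_nonneg) le_rfl]
  conv_lhs => rw [← dStieltjes_restrict hF]
  rw [VectorMeasure.restrict_apply _ measurableSet_Ico .univ, univ_inter]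

theorem withDensityᵥ_variation_dStieltjes_of_monotone (hmono : Monotone F) :
    (dStieltjes hF).variation.withDensityᵥ (fun _ => (1 : ℂ)) = dStieltjes hF := by
  have hle : -π ≤ π := neg_le_self Real.pi_nonneg
  refine vectorMeasure_eq_variation_of_univ ?_
  rw [measureReal_def, variation_dStieltjes_univ, dStieltjes_univ]
  exact ENNReal.toReal_le_of_le_ofReal (Complex.nonneg_iff.1 (sub_nonneg.2 (hmono hle))).1
    (eVariationOn_le_of_monotoneOn hle (hmono.monotoneOn _))

theorem mem_Icc_leftLim_rightLim (hpos : ∀ s, MeasurableSet s → 0 ≤ dStieltjes hF s) {t : ℝ}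
    (ht : t ∈ Ico (-π) π) : F t ∈ Icc (Function.leftLim F t) (Function.rightLim F t) := by
  refine segment_subset_Icc (𝕜 := ℝ) (sub_nonneg.1 ?_) (hF.normalized t)
  rw [← dStieltjes_singleton hF ht.1 ht.2]
  exact hpos _ (measurableSet_singleton t)

theorem leftLim_le_of_dStieltjes_nonneg (hpos : ∀ s, MeasurableSet s → 0 ≤ dStieltjes hF s)
    {t : ℝ} (ht : t ∈ Icc (-π) π) : Function.leftLim F t ≤ F t := by
  rcases ht.2.eq_or_lt with rfl | hlt
  · rw [← sub_nonneg, pi_sub_leftLim_pi hF]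
    exact sub_nonneg.2 (mem_Icc_leftLim_rightLim hF hpos ⟨le_rfl, by linarith [Real.pi_pos]⟩).1
  · exact (mem_Icc_leftLim_rightLim hF hpos ⟨ht.1, hlt⟩).1

theorem monotone_of_dStieltjes_nonneg (hpos : ∀ s, MeasurableSet s → 0 ≤ dStieltjes hF s) :
    Monotone F := by
  obtain ⟨m, hm⟩ := hF.periodic_increment
  let F' : ℝ →+c[2 * π, m] ℂ := ⟨F, hm⟩
  refine (AddConstMapClass.monotone_iff_Icc (f := F') two_pi_pos (-π)).2 fun x hx y hy hxy => ?_
  rw [neg_pi_add_two_pi] at hx hy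
  rcases hxy.eq_or_lt with rfl | hlt
  · rfl
  calc F x ≤ Function.rightLim F x :=
        (mem_Icc_leftLim_rightLim hF hpos ⟨hx.1, hlt.trans_le hy.2⟩).2
    _ ≤ Function.leftLim F y := by
        rw [← sub_nonneg, ← dStieltjes_Ioo hF hx.1 hlt hy.2]
        exact hpos _ measurableSet_Ioo
    _ ≤ F y := leftLim_le_of_dStieltjes_nonneg hF hpos hy

theorem isIncreasing_iff_exists_measure : IsIncreasing F ↔
    ∃ m : Measure ℝ, IsFiniteMeasure m ∧ m.withDensityᵥ (fun _ => (1 : ℂ)) = dStieltjes hF := by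
  rw [isIncreasing_iff_monotone]
  refine ⟨fun h => ⟨_, inferInstance, withDensityᵥ_variation_dStieltjes_of_monotone hF h⟩, ?_⟩
  rintro ⟨m, hm, h⟩
  refine monotone_of_dStieltjes_nonneg hF fun s hs => ?_
  rw [← h, withDensityᵥ_apply (integrable_const _) hs, setIntegral_const, Complex.real_smul,
    mul_one]
  exact Complex.zero_le_real.2 measureReal_nonneg

end Monotone

section FourierStieltjes

theorem norm_exp_I_mul_mul (x y : ℝ) : ‖Complex.exp (Complex.I * x * y)‖ = 1 := by
  rw [mul_assoc, mul_comm, ← Complex.ofReal_mul, Complex.norm_exp_ofReal_mul_I]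

theorem integrable_exp_I_mul_comp {X : Type*} [MeasurableSpace X] (m : Measure X)
    [IsFiniteMeasure m] {f : X → ℝ} (hf : Measurable f) (x : ℝ) :
    Integrable (fun y => Complex.exp (Complex.I * x * f y)) m :=
  Integrable.of_bound (by fun_prop) 1
    (Eventually.of_forall fun y => (norm_exp_I_mul_mul x (f y)).le)

theorem integrable_exp_I_mul_mul (m : Measure ℝ) [IsFiniteMeasure m] (x : ℝ) :
    Integrable (fun y : ℝ => Complex.exp (Complex.I * x * y)) m :=
  integrable_exp_I_mul_comp m measurable_id x

variable (μ ν : ComplexMeasure ℝ) [IsFiniteMeasure μ.variation] [IsFiniteMeasure ν.variation]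

theorem fourierStieltjes_add (x : ℝ) :
    fourierStieltjes (μ + ν) x = fourierStieltjes μ x + fourierStieltjes ν x :=
  VectorMeasure.integral_add_vectorMeasure (integrable_exp_I_mul_mul _ x)
    (integrable_exp_I_mul_mul _ x)

theorem fourierStieltjes_sub (x : ℝ) :
    fourierStieltjes (μ - ν) x = fourierStieltjes μ x - fourierStieltjes ν x :=
  VectorMeasure.integral_sub_vectorMeasure (integrable_exp_I_mul_mul _ x)
    (integrable_exp_I_mul_mul _ x)

theorem norm_fourierStieltjes_le (μ : ComplexMeasure ℝ) (x : ℝ) :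
    ‖fourierStieltjes μ x‖ ≤ (μ.variation univ).toReal := by
  refine VectorMeasure.norm_integral_le_integral_norm.trans ?_
  simp [norm_exp_I_mul_mul, measureReal_def]

theorem fourierStieltjes_dirac (a : ℝ) (c : ℂ) (x : ℝ) :
    fourierStieltjes (VectorMeasure.dirac a c) x = Complex.exp (Complex.I * x * a) * c :=
  VectorMeasure.integral_dirac

theorem fourierStieltjes_withDensityᵥ {m : Measure ℝ} {h : ℝ → ℂ} (hh : Integrable h m) (x : ℝ) :
    fourierStieltjes (m.withDensityᵥ h) x = ∫ y, Complex.exp (Complex.I * x * y) * h y ∂m :=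
  have := isFiniteMeasure_variation_withDensityᵥ hh
  integral_withDensityᵥ _ hh (integrable_exp_I_mul_mul _ x)

theorem fourierStieltjes_map {X : Type*} [MeasurableSpace X] (μ : ComplexMeasure X)
    [IsFiniteMeasure μ.variation] {f : X → ℝ} (hf : Measurable f) (x : ℝ) :
    fourierStieltjes (μ.map f) x =
      μ.integral (fun y => Complex.exp (Complex.I * x * f y)) (ContinuousLinearMap.mul ℝ ℂ) :=
  VectorMeasure.integral_map hf (by fun_prop) (integrable_exp_I_mul_comp _ hf x)

theorem fourierStieltjes_map_neg (x : ℝ) :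
    fourierStieltjes (μ.map Neg.neg) x = fourierStieltjes μ (-x) := by
  rw [fourierStieltjes_map μ measurable_neg, fourierStieltjes]
  simp only [Complex.ofReal_neg, mul_neg, neg_mul]

theorem variation_map_univ_le {X Y : Type*} [MeasurableSpace X] [MeasurableSpace Y]
    (μ : ComplexMeasure X) {f : X → Y} (hf : Measurable f) :
    (μ.map f).variation univ ≤ μ.variation univ := by
  simpa [Measure.map_apply hf] using VectorMeasure.variation_map_le (μ := μ) (φ := f) univ

theorem phi₀_eq_fourierStieltjes {F : ℝ → ℂ} (hF : IsBVCircle F) (x : ℝ) :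
    phi₀ hF x = fourierStieltjes (dStieltjes hF) (-x) := by
  simp only [phi₀, fourierStieltjes, Complex.ofReal_neg, mul_neg, neg_mul]

theorem isFourierStieltjesSeries_iff {c : ℤ → ℂ} {F : ℝ → ℂ} (hF : IsBVCircle F) :
    IsFourierStieltjesSeries c hF ↔ ∀ k : ℤ, c k = fourierStieltjes (dStieltjes hF) (-k) := by
  simp only [IsFourierStieltjesSeries, fourierStieltjes, Complex.ofReal_neg, Complex.ofReal_intCast,
    mul_neg, neg_mul]

end FourierStieltjes

section Wrap

instance fact_two_pi_pos : Fact (0 < 2 * π) := ⟨two_pi_pos⟩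

theorem fourier_coe_two_pi (n : ℤ) (t : ℝ) :
    fourier n (t : AddCircle (2 * π)) = Complex.exp (Complex.I * (n : ℝ) * t) := by
  have hpi : (π : ℂ) ≠ 0 := Complex.ofReal_ne_zero.2 pi_ne_zero
  rw [fourier_coe_apply]
  congr 1
  push_cast
  field_simp

theorem integral_fourier_map_coe (μ : ComplexMeasure ℝ) [IsFiniteMeasure μ.variation] (n : ℤ) :
    (μ.map ((↑) : ℝ → AddCircle (2 * π))).integral (fourier n) (ContinuousLinearMap.mul ℝ ℂ) =
      fourierStieltjes μ n := by
  have hcoe : fourier n ∘ ((↑) : ℝ → AddCircle (2 * π)) =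
      fun t : ℝ => Complex.exp (Complex.I * (n : ℝ) * t) := funext (fourier_coe_two_pi n)
  rw [VectorMeasure.integral_map AddCircle.measurable_mk'
    (fourier n).continuous.aestronglyMeasurable (hcoe ▸ integrable_exp_I_mul_mul _ n),
    fourierStieltjes]
  exact congrArg (μ.integral · _) hcoe

theorem exists_measurableSet_preimage_coe_inter_Ico {T : ℝ} [Fact (0 < T)] (a : ℝ) {s : Set ℝ}
    (hs : MeasurableSet s) : ∃ t : Set (AddCircle T), MeasurableSet t ∧
      ((↑) : ℝ → AddCircle T) ⁻¹' t ∩ Ico a (a + T) = s ∩ Ico a (a + T) := by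
  refine ⟨{z | (AddCircle.equivIco T a z : ℝ) ∈ s},
    (measurable_subtype_coe.comp (AddCircle.measurableEquivIco T a).measurable) hs, ?_⟩
  ext x
  simp only [mem_inter_iff, mem_preimage, mem_ofPred_eq, and_congr_left_iff]
  intro hx
  rw [AddCircle.equivIco_coe_of_mem hx]

theorem eq_zero_of_map_coe_eq_zero {E : Type*} [AddCommMonoid E] [TopologicalSpace E] {T : ℝ}
    [Fact (0 < T)] {a : ℝ} {μ : VectorMeasure ℝ E} (hμ : μ.restrict (Ico a (a + T)) = μ)
    (h : μ.map ((↑) : ℝ → AddCircle T) = 0) : μ = 0 := by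
  ext s hs
  obtain ⟨t, ht, hts⟩ := exists_measurableSet_preimage_coe_inter_Ico (T := T) a hs
  have hcoe : Measurable ((↑) : ℝ → AddCircle T) := AddCircle.measurable_mk'
  rw [← hμ, VectorMeasure.restrict_apply _ measurableSet_Ico hs, ← hts,
    ← VectorMeasure.restrict_apply _ measurableSet_Ico (hcoe ht), hμ,
    ← VectorMeasure.map_apply _ hcoe ht, h]
  rfl

theorem eq_of_fourierStieltjes_intCast_eq {μ ν : ComplexMeasure ℝ} [IsFiniteMeasure μ.variation]
    [IsFiniteMeasure ν.variation] {a : ℝ} (hμ : μ.restrict (Ico a (a + 2 * π)) = μ)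
    (hν : ν.restrict (Ico a (a + 2 * π)) = ν)
    (h : ∀ k : ℤ, fourierStieltjes μ k = fourierStieltjes ν k) : μ = ν := by
  have : IsFiniteMeasure (μ - ν).variation :=
    isFiniteMeasure_of_le _ VectorMeasure.variation_sub_le
  have hzero : (μ - ν).map ((↑) : ℝ → AddCircle (2 * π)) = 0 :=
    eq_zero_of_integral_fourier_eq_zero fun n => by
      rw [integral_fourier_map_coe, fourierStieltjes_sub, h, sub_self]
  refine sub_eq_zero.1 (eq_zero_of_map_coe_eq_zero (a := a) ?_ hzero)
  rw [VectorMeasure.restrict_sub, hμ, hν]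

/-- The point of `[-π, π)` congruent to `-y` modulo `2π`. The reflection accounts for the sign in
`c_k = ∫ e^{-ikt} dF(t)`: if `φ` is the transform of `μ`, then the numbers `φ k` are the
Fourier–Stieltjes coefficients of the image of `μ` under this map. -/
noncomputable def reflectMod (y : ℝ) : ℝ := toIcoMod two_pi_pos (-π) (-y)

theorem measurable_toIcoMod {p : ℝ} (hp : 0 < p) (a : ℝ) : Measurable (toIcoMod hp a) := by
  simp only [funext (toIcoMod_eq_add_fract_mul hp a)]
  fun_prop

theorem measurable_reflectMod : Measurable reflectMod :=
  (measurable_toIcoMod two_pi_pos (-π)).comp measurable_neg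

theorem reflectMod_mem_Ico (y : ℝ) : reflectMod y ∈ Ico (-π) π := by
  simpa only [reflectMod, neg_pi_add_two_pi] using toIcoMod_mem_Ico two_pi_pos (-π) (-y)

theorem exists_reflectMod_eq (y : ℝ) : ∃ n : ℤ, reflectMod y = n * (2 * π) - y :=
  ⟨-toIcoDiv two_pi_pos (-π) (-y), by
    rw [reflectMod, toIcoMod, zsmul_eq_mul]
    push_cast
    ring⟩

theorem exp_I_mul_reflectMod (k : ℤ) (y : ℝ) :
    Complex.exp (Complex.I * (-k : ℝ) * reflectMod y) =
      Complex.exp (Complex.I * (k : ℝ) * y) := by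
  obtain ⟨n, hn⟩ := exists_reflectMod_eq y
  refine Complex.exp_eq_exp_iff_exists_int.2 ⟨-(k * n), ?_⟩
  rw [hn]
  push_cast
  ring

theorem fourierStieltjes_map_reflectMod (μ : ComplexMeasure ℝ) [IsFiniteMeasure μ.variation]
    (k : ℤ) : fourierStieltjes (μ.map reflectMod) (-k) = fourierStieltjes μ k := by
  rw [fourierStieltjes_map μ measurable_reflectMod, fourierStieltjes]
  simp only [exp_I_mul_reflectMod]

theorem map_restrict_of_forall_mem {X Y E : Type*} [MeasurableSpace X] [MeasurableSpace Y]
    [AddCommMonoid E] [TopologicalSpace E] (μ : VectorMeasure X E) {f : X → Y} (hf : Measurable f)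
    {s : Set Y} (hs : MeasurableSet s) (hfs : ∀ x, f x ∈ s) :
    (μ.map f).restrict s = μ.map f := by
  rw [VectorMeasure.restrict_map _ hf hs, preimage_eq_univ_iff.2 (range_subset_iff.2 hfs),
    VectorMeasure.restrict_univ]

theorem map_reflectMod_restrict {E : Type*} [AddCommMonoid E] [TopologicalSpace E]
    (μ : VectorMeasure ℝ E) : (μ.map reflectMod).restrict (Ico (-π) π) = μ.map reflectMod :=
  map_restrict_of_forall_mem μ measurable_reflectMod measurableSet_Ico reflectMod_mem_Ico

theorem quasiMeasurePreserving_of_forall_exists_eq {X Y ι : Type*} [Countable ι]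
    [MeasurableSpace X] [MeasurableSpace Y] {m : Measure X} {m' : Measure Y} {f : X → Y}
    {g : ι → X → Y} (hf : Measurable f) (hg : ∀ i, Measure.QuasiMeasurePreserving (g i) m m')
    (h : ∀ x, ∃ i, f x = g i x) : Measure.QuasiMeasurePreserving f m m' := by
  refine ⟨hf, Measure.AbsolutelyContinuous.mk fun s hs h0 => ?_⟩
  rw [Measure.map_apply hf hs]
  refine measure_mono_null (t := ⋃ i, g i ⁻¹' s) (fun x hx => ?_)
    (measure_iUnion_null fun i => (hg i).preimage_null h0)
  obtain ⟨i, hi⟩ := h x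
  exact mem_iUnion.2 ⟨i, by rwa [mem_preimage, ← hi]⟩

theorem quasiMeasurePreserving_reflectMod :
    Measure.QuasiMeasurePreserving reflectMod volume (volume.restrict (Ico (-π) π)) := by
  have hvol : Measure.QuasiMeasurePreserving reflectMod volume volume :=
    quasiMeasurePreserving_of_forall_exists_eq measurable_reflectMod
      (fun n : ℤ => quasiMeasurePreserving_sub_left volume (n * (2 * π))) exists_reflectMod_eq
  simpa [preimage_eq_univ_iff.2 (range_subset_iff.2 reflectMod_mem_Ico)] using
    hvol.restrict (mapsTo_preimage reflectMod (Ico (-π) π))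

theorem absolutelyContinuous_map {X Y E : Type*} [MeasurableSpace X] [MeasurableSpace Y]
    [AddCommMonoid E] [TopologicalSpace E] {m : Measure X} {m' : Measure Y}
    {μ : VectorMeasure X E} {f : X → Y} (hμ : μ ≪ᵥ m.toENNRealVectorMeasure)
    (hf : Measure.QuasiMeasurePreserving f m m') : μ.map f ≪ᵥ m'.toENNRealVectorMeasure := by
  refine VectorMeasure.AbsolutelyContinuous.mk fun s hs h0 => ?_
  rw [Measure.toENNRealVectorMeasure_apply_measurable hs] at h0
  rw [VectorMeasure.map_apply _ hf.measurable hs]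
  refine hμ ?_
  rw [Measure.toENNRealVectorMeasure_apply_measurable (hf.measurable hs)]
  exact hf.preimage_null h0

end Wrap

section Extensions

variable {F : ℝ → ℂ} {c : ℤ → ℂ} {φ ψ : ℝ → ℂ} {μ ν : ComplexMeasure ℝ}

theorem Represents.isFiniteMeasure (h : Represents μ φ) : IsFiniteMeasure μ.variation := ⟨h.1⟩

theorem Represents.add (hμ : Represents μ φ) (hν : Represents ν ψ) :
    Represents (μ + ν) (φ + ψ) := by
  have := hμ.isFiniteMeasure
  have := hν.isFiniteMeasure
  refine ⟨(VectorMeasure.variation_add_le univ).trans_lt (ENNReal.add_lt_top.2 ⟨hμ.1, hν.1⟩),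
    fun x => ?_⟩
  rw [fourierStieltjes_add, Pi.add_apply, hμ.2, hν.2]

theorem Represents.norm_le (h : Represents μ φ) (x : ℝ) : ‖φ x‖ ≤ (μ.variation univ).toReal :=
  h.2 x ▸ norm_fourierStieltjes_le μ x

theorem represents_dirac (a : ℝ) (c : ℂ) :
    Represents (VectorMeasure.dirac a c) fun x => Complex.exp (Complex.I * x * a) * c :=
  ⟨measure_lt_top _ _, fun x => (fourierStieltjes_dirac a c x).symm⟩

theorem const_mul_sin_mem_W (a : ℝ) (l : ℂ) : (fun x : ℝ => l * Real.sin (a * x)) ∈ W := by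
  have h := (represents_dirac (-a) (l * Complex.I / 2)).add
    (represents_dirac a (-(l * Complex.I / 2)))
  refine ⟨_, h.1, fun x => ?_⟩
  rw [← h.2, Pi.add_apply]
  dsimp only
  rw [Complex.ofReal_sin, Complex.sin]
  push_cast
  ring_nf

theorem add_mem_W (hφ : φ ∈ W) (hψ : ψ ∈ W) : φ + ψ ∈ W := by
  obtain ⟨μ, hμ⟩ := hφ
  obtain ⟨ν, hν⟩ := hψ
  exact ⟨μ + ν, hμ.add hν⟩

theorem represents_phi₀ (hF : IsBVCircle F) :
    Represents ((dStieltjes hF).map Neg.neg) (phi₀ hF) :=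
  ⟨measure_lt_top _ _, fun x => by
    rw [fourierStieltjes_map_neg, phi₀_eq_fourierStieltjes]⟩

theorem phi₀_mem_W (hF : IsBVCircle F) : phi₀ hF ∈ W := ⟨_, represents_phi₀ hF⟩

theorem extends_phi₀ (hF : IsBVCircle F) (hc : IsFourierStieltjesSeries c hF) :
    Extends (phi₀ hF) c := fun k => by
  rw [phi₀_eq_fourierStieltjes, (isFourierStieltjesSeries_iff hF).1 hc k]

theorem dStieltjes_eq_of_coeff_eq (hF : IsBVCircle F) (hc : IsFourierStieltjesSeries c hF)
    [IsFiniteMeasure ν.variation] (hν : ν.restrict (Ico (-π) π) = ν)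
    (h : ∀ k : ℤ, c k = fourierStieltjes ν (-k)) : dStieltjes hF = ν := by
  rw [isFourierStieltjesSeries_iff] at hc
  refine eq_of_fourierStieltjes_intCast_eq (a := -π)
    (by rw [neg_pi_add_two_pi, dStieltjes_restrict hF]) (by rwa [neg_pi_add_two_pi]) fun k => ?_
  have hk := (hc (-k)).symm.trans (h (-k))
  rwa [Int.cast_neg, neg_neg] at hk

theorem dStieltjes_eq_map_reflectMod (hF : IsBVCircle F) (hc : IsFourierStieltjesSeries c hF)
    (hμ : Represents μ φ) (hφ : Extends φ c) : dStieltjes hF = μ.map reflectMod := by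
  have := hμ.isFiniteMeasure
  exact dStieltjes_eq_of_coeff_eq hF hc (map_reflectMod_restrict μ) fun k => by
    rw [fourierStieltjes_map_reflectMod, ← hμ.2, hφ]

theorem exists_isFourierStieltjesSeries_of_represents (hμ : Represents μ φ) (hφ : Extends φ c) :
    ∃ (F : ℝ → ℂ) (hF : IsBVCircle F), IsFourierStieltjesSeries c hF := by
  have := hμ.isFiniteMeasure
  refine ⟨_, isBVCircle_primitive (μ.map reflectMod), (isFourierStieltjesSeries_iff _).2
    fun k => ?_⟩
  rw [dStieltjes_primitive _ (map_reflectMod_restrict μ), fourierStieltjes_map_reflectMod, ← hμ.2,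
    hφ]

theorem exists_isFourierStieltjesSeries_iff :
    (∃ (F : ℝ → ℂ) (hF : IsBVCircle F), IsFourierStieltjesSeries c hF) ↔
      ∃ φ ∈ W, Extends φ c := by
  constructor
  · rintro ⟨F, hF, hc⟩
    exact ⟨phi₀ hF, phi₀_mem_W hF, extends_phi₀ hF hc⟩
  · rintro ⟨φ, ⟨μ, hμ⟩, hφ⟩
    exact exists_isFourierStieltjesSeries_of_represents hμ hφ

theorem totalVar_le_wNorm (hF : IsBVCircle F) (hc : IsFourierStieltjesSeries c hF)
    (hφ : φ ∈ W) (hφc : Extends φ c) : totalVar F ≤ wNorm φ := by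
  obtain ⟨μ, hμ⟩ := hφ
  refine le_csInf ⟨_, μ, hμ, rfl⟩ ?_
  rintro _ ⟨ν, hν, rfl⟩
  rw [totalVar_eq_variation hF, dStieltjes_eq_map_reflectMod hF hc hν hφc]
  exact ENNReal.toReal_mono hν.1.ne (variation_map_univ_le ν measurable_reflectMod)

theorem Represents.wNorm_le (h : Represents μ φ) : wNorm φ ≤ (μ.variation univ).toReal := by
  refine csInf_le ⟨0, ?_⟩ ⟨μ, h, rfl⟩
  rintro _ ⟨ν, -, rfl⟩
  exact ENNReal.toReal_nonneg

theorem wNorm_phi₀_le (hF : IsBVCircle F) : wNorm (phi₀ hF) ≤ totalVar F := by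
  rw [totalVar_eq_variation hF]
  exact (represents_phi₀ hF).wNorm_le.trans (ENNReal.toReal_mono (measure_ne_top _ _)
    (variation_map_univ_le _ measurable_neg))

theorem wNorm_phi₀ (hF : IsBVCircle F) (hc : IsFourierStieltjesSeries c hF) :
    wNorm (phi₀ hF) = totalVar F :=
  (wNorm_phi₀_le hF).antisymm (totalVar_le_wNorm hF hc (phi₀_mem_W hF) (extends_phi₀ hF hc))

theorem isLeast_wNorm (hF : IsBVCircle F) (hc : IsFourierStieltjesSeries c hF) :
    IsLeast {r : ℝ | ∃ φ ∈ W, Extends φ c ∧ r = wNorm φ} (totalVar F) := by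
  refine ⟨⟨phi₀ hF, phi₀_mem_W hF, extends_phi₀ hF hc, (wNorm_phi₀ hF hc).symm⟩, ?_⟩
  rintro _ ⟨φ, hφ, hφc, rfl⟩
  exact totalVar_le_wNorm hF hc hφ hφc

theorem isFiniteMeasure_variation_of_absolutelyContinuous {X : Type*} [MeasurableSpace X]
    {m : Measure X} [SigmaFinite m] {ν : ComplexMeasure X} (h : ν ≪ᵥ m.toENNRealVectorMeasure) :
    IsFiniteMeasure ν.variation := by
  rw [← withDensityᵥ_complexMeasure_rnDeriv_eq h]
  exact isFiniteMeasure_variation_withDensityᵥ (ComplexMeasure.integrable_rnDeriv ν m)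

theorem mem_W₀_iff : φ ∈ W₀ ↔
    ∃ μ : ComplexMeasure ℝ, μ ≪ᵥ volume.toENNRealVectorMeasure ∧ Represents μ φ := by
  constructor
  · rintro ⟨g, hg, h⟩
    refine ⟨volume.withDensityᵥ g, ?_, ?_, fun x => ?_⟩
    · exact absolutelyContinuous_withDensityᵥ hg
    · exact (isFiniteMeasure_variation_withDensityᵥ hg).1
    · rw [h, fourierStieltjes_withDensityᵥ hg]
  · rintro ⟨μ, hμ, h⟩
    have hg := ComplexMeasure.integrable_rnDeriv μ volume
    refine ⟨ComplexMeasure.rnDeriv μ volume, hg, fun x => ?_⟩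
    rw [← fourierStieltjes_withDensityᵥ hg, withDensityᵥ_complexMeasure_rnDeriv_eq hμ, h.2]

theorem isFourierSeries_iff_exists_integrableOn : IsFourierSeries c ↔
    ∃ g : ℝ → ℂ, IntegrableOn g (Ico (-π) π) ∧ ∀ k : ℤ,
      c k = fourierStieltjes ((volume.restrict (Ico (-π) π)).withDensityᵥ g) (-k) := by
  have hpi : (π : ℂ) ≠ 0 := Complex.ofReal_ne_zero.2 pi_ne_zero
  constructor
  · rintro ⟨f, hf, h⟩
    refine ⟨fun t => 1 / (2 * π) * f t, hf.const_mul _, fun k => ?_⟩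
    rw [h, fourierStieltjes_withDensityᵥ (hf.const_mul _), ← integral_const_mul]
    refine integral_congr_ae (Eventually.of_forall fun t => ?_)
    push_cast
    ring_nf
  · rintro ⟨g, hg, h⟩
    refine ⟨fun t => 2 * π * g t, hg.const_mul _, fun k => ?_⟩
    rw [h, fourierStieltjes_withDensityᵥ hg, ← integral_const_mul]
    refine integral_congr_ae (Eventually.of_forall fun t => ?_)
    push_cast
    field_simp

theorem isFourierSeries_iff_exists_absolutelyContinuous : IsFourierSeries c ↔
    ∃ ν : ComplexMeasure ℝ, ν ≪ᵥ (volume.restrict (Ico (-π) π)).toENNRealVectorMeasure ∧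
      ∀ k : ℤ, c k = fourierStieltjes ν (-k) := by
  rw [isFourierSeries_iff_exists_integrableOn]
  constructor
  · rintro ⟨g, hg, h⟩
    exact ⟨_, absolutelyContinuous_withDensityᵥ hg, h⟩
  · rintro ⟨ν, hν, h⟩
    exact ⟨_, ComplexMeasure.integrable_rnDeriv ν _, by
      rwa [withDensityᵥ_complexMeasure_rnDeriv_eq hν]⟩

theorem absolutelyContinuous_map_neg {s : Set ℝ}
    (hν : ν ≪ᵥ (volume.restrict s).toENNRealVectorMeasure) :
    ν.map Neg.neg ≪ᵥ volume.toENNRealVectorMeasure :=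
  absolutelyContinuous_map hν
    ((Measure.measurePreserving_neg volume).quasiMeasurePreserving.mono_left
      Measure.absolutelyContinuous_restrict)

theorem isFourierSeries_iff : IsFourierSeries c ↔ ∃ φ ∈ W₀, Extends φ c := by
  rw [isFourierSeries_iff_exists_absolutelyContinuous]
  constructor
  · rintro ⟨ν, hν, h⟩
    have := isFiniteMeasure_variation_of_absolutelyContinuous hν
    refine ⟨fourierStieltjes (ν.map Neg.neg),
      mem_W₀_iff.2 ⟨_, absolutelyContinuous_map_neg hν, measure_lt_top _ _, fun x => rfl⟩,
      fun k => ?_⟩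
    rw [fourierStieltjes_map_neg, h]
  · rintro ⟨φ, hφ, hφc⟩
    obtain ⟨μ, hμ, h⟩ := mem_W₀_iff.1 hφ
    have := h.isFiniteMeasure
    refine ⟨μ.map reflectMod, absolutelyContinuous_map hμ quasiMeasurePreserving_reflectMod,
      fun k => ?_⟩
    rw [fourierStieltjes_map_reflectMod, ← h.2, hφc]

theorem restrict_eq_of_absolutelyContinuous_restrict {X : Type*} [MeasurableSpace X]
    {m : Measure X} [SigmaFinite m] {ν : ComplexMeasure X} {s : Set X} (hs : MeasurableSet s)
    (hν : ν ≪ᵥ (m.restrict s).toENNRealVectorMeasure) : ν.restrict s = ν := by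
  rw [← withDensityᵥ_complexMeasure_rnDeriv_eq hν,
    withDensityᵥ_restrict (ComplexMeasure.integrable_rnDeriv _ _) hs,
    Measure.restrict_restrict hs, inter_self]

theorem phi₀_mem_W₀ (hF : IsBVCircle F) (hc : IsFourierStieltjesSeries c hF)
    (h : IsFourierSeries c) : phi₀ hF ∈ W₀ := by
  obtain ⟨ν, hν, hcν⟩ := isFourierSeries_iff_exists_absolutelyContinuous.1 h
  have := isFiniteMeasure_variation_of_absolutelyContinuous hν
  have heq : dStieltjes hF = ν := dStieltjes_eq_of_coeff_eq hF hc
    (restrict_eq_of_absolutelyContinuous_restrict measurableSet_Ico hν) hcν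
  exact mem_W₀_iff.2 ⟨_, absolutelyContinuous_map_neg (heq ▸ hν), represents_phi₀ hF⟩

theorem withDensityᵥ_const_map {X Y E : Type*} [MeasurableSpace X] [MeasurableSpace Y]
    [NormedAddCommGroup E] [NormedSpace ℝ E] [CompleteSpace E] (m : Measure X) [IsFiniteMeasure m]
    {f : X → Y} (hf : Measurable f) (a : E) :
    (m.withDensityᵥ fun _ => a).map f = (m.map f).withDensityᵥ fun _ => a := by
  ext s hs
  rw [VectorMeasure.map_apply _ hf hs, withDensityᵥ_apply (integrable_const a) (hf hs),
    withDensityᵥ_apply (integrable_const a) hs, setIntegral_const, setIntegral_const,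
    map_measureReal_apply hf hs]

theorem mem_WPos_iff : φ ∈ WPos ↔ ∃ m : Measure ℝ, IsFiniteMeasure m ∧
    Represents (m.withDensityᵥ fun _ => (1 : ℂ)) φ := by
  refine exists_congr fun m => and_congr_right fun hm => ?_
  have hone : Integrable (fun _ => (1 : ℂ)) m := integrable_const 1
  have hfin := isFiniteMeasure_variation_withDensityᵥ hone
  simp only [Represents, measure_lt_top, true_and, fourierStieltjes_withDensityᵥ hone, mul_one]

theorem isIncreasing_iff (hF : IsBVCircle F) (hc : IsFourierStieltjesSeries c hF) :
    IsIncreasing F ↔ ∃ φ ∈ WPos, Extends φ c := by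
  rw [isIncreasing_iff_exists_measure hF]
  constructor
  · rintro ⟨m, hm, h⟩
    refine ⟨phi₀ hF, mem_WPos_iff.2 ⟨m.map Neg.neg, inferInstance, ?_⟩, extends_phi₀ hF hc⟩
    rw [← withDensityᵥ_const_map m measurable_neg, h]
    exact represents_phi₀ hF
  · rintro ⟨φ, hφ, hφc⟩
    obtain ⟨m, hm, h⟩ := mem_WPos_iff.1 hφ
    refine ⟨m.map reflectMod, inferInstance, ?_⟩
    rw [dStieltjes_eq_map_reflectMod hF hc h hφc,
      withDensityᵥ_const_map m measurable_reflectMod]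

end Extensions

section ExponentialType

variable {f g : ℂ → ℂ} {σ C : ℝ}

theorem isEntireOfExpType_of_norm_le (hg : Differentiable ℂ g)
    (hC : ∀ z, ‖g z‖ ≤ C * Real.exp (σ * ‖z‖)) : IsEntireOfExpType σ g := by
  have hC0 : 0 ≤ C := by simpa using (norm_nonneg _).trans (hC 0)
  refine ⟨hg, fun ε hε => ⟨C, fun z => (hC z).trans ?_⟩⟩
  gcongr
  linarith

namespace IsEntireOfExpType

theorem add (hf : IsEntireOfExpType σ f) (hg : IsEntireOfExpType σ g) :
    IsEntireOfExpType σ (f + g) := by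
  refine ⟨hf.1.add hg.1, fun ε hε => ?_⟩
  obtain ⟨C, hC⟩ := hf.2 ε hε
  obtain ⟨D, hD⟩ := hg.2 ε hε
  exact ⟨C + D, fun z => (norm_add_le_of_le (hC z) (hD z)).trans_eq (add_mul _ _ _).symm⟩

theorem const_mul (hf : IsEntireOfExpType σ f) (l : ℂ) :
    IsEntireOfExpType σ fun z => l * f z := by
  refine ⟨hf.1.const_mul l, fun ε hε => ?_⟩
  obtain ⟨C, hC⟩ := hf.2 ε hε
  refine ⟨‖l‖ * C, fun z => ?_⟩
  rw [norm_mul, mul_assoc]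
  exact mul_le_mul_of_nonneg_left (hC z) (norm_nonneg l)

theorem sub (hf : IsEntireOfExpType σ f) (hg : IsEntireOfExpType σ g) :
    IsEntireOfExpType σ (f - g) := by
  convert hf.add (hg.const_mul (-1)) using 1
  ext z
  simp [sub_eq_add_neg]

theorem comp_neg (hf : IsEntireOfExpType σ f) : IsEntireOfExpType σ fun z => f (-z) := by
  refine ⟨hf.1.comp differentiable_neg, fun ε hε => ?_⟩
  obtain ⟨C, hC⟩ := hf.2 ε hε
  exact ⟨C, fun z => by simpa using hC (-z)⟩

end IsEntireOfExpType

theorem norm_sin_le_exp_norm (z : ℂ) : ‖Complex.sin z‖ ≤ Real.exp ‖z‖ := by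
  have h₁ := Complex.norm_exp_le_exp_norm (-z * Complex.I)
  have h₂ := Complex.norm_exp_le_exp_norm (z * Complex.I)
  have h₃ := norm_sub_le (Complex.exp (-z * Complex.I)) (Complex.exp (z * Complex.I))
  rw [norm_mul, Complex.norm_I, mul_one] at h₁ h₂
  rw [norm_neg] at h₁
  rw [Complex.sin, norm_div, norm_mul, Complex.norm_I, mul_one, Complex.norm_two]
  linarith

theorem isEntireOfExpType_sin (a : ℝ) : IsEntireOfExpType |a| fun z => Complex.sin (a * z) :=
  isEntireOfExpType_of_norm_le (C := 1) (by fun_prop) fun z => by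
    simpa using norm_sin_le_exp_norm (a * z)

section FourierIntegral

variable {m : Measure ℝ} {h : ℝ → ℂ}

theorem norm_exp_I_mul_mul_le (z : ℂ) {t : ℝ} (ht : |t| ≤ σ) :
    ‖Complex.exp (Complex.I * z * t)‖ ≤ Real.exp (σ * ‖z‖) := by
  refine (Complex.norm_exp_le_exp_norm _).trans (Real.exp_le_exp.2 ?_)
  rw [norm_mul, norm_mul, Complex.norm_I, one_mul, Complex.norm_real, Real.norm_eq_abs, mul_comm]
  exact mul_le_mul_of_nonneg_right ht (norm_nonneg z)

theorem ae_norm_exp_mul_le (hm : ∀ᵐ t ∂m, |t| ≤ σ) (z : ℂ) :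
    ∀ᵐ t : ℝ ∂m, ‖Complex.exp (Complex.I * z * t) * h t‖ ≤ Real.exp (σ * ‖z‖) * ‖h t‖ := by
  filter_upwards [hm] with t ht
  rw [norm_mul]
  exact mul_le_mul_of_nonneg_right (norm_exp_I_mul_mul_le z ht) (norm_nonneg _)

theorem differentiable_integral_exp_I_mul (hh : Integrable h m) (hm : ∀ᵐ t ∂m, |t| ≤ σ) :
    Differentiable ℂ fun z => ∫ t : ℝ, Complex.exp (Complex.I * z * t) * h t ∂m := by
  intro z
  have hmeas (w : ℂ) :
      AEStronglyMeasurable (fun t : ℝ => Complex.exp (Complex.I * w * t) * h t) m :=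
    (Continuous.aestronglyMeasurable (by fun_prop)).mul hh.1
  have hderiv (w : ℂ) (t : ℝ) : HasDerivAt (fun w => Complex.exp (Complex.I * w * t) * h t)
      (Complex.exp (Complex.I * w * t) * (Complex.I * t) * h t) w := by
    simpa using ((((hasDerivAt_id w).const_mul Complex.I).mul_const (t : ℂ)).cexp).mul_const (h t)
  refine (hasDerivAt_integral_of_dominated_loc_of_deriv_le (Metric.ball_mem_nhds z one_pos)
    (bound := fun t => Real.exp (|σ| * (‖z‖ + 1)) * |σ| * ‖h t‖)
    (Eventually.of_forall hmeas)
    ((hh.norm.const_mul (Real.exp (σ * ‖z‖))).mono' (hmeas z) (ae_norm_exp_mul_le hm z))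
    ((Continuous.aestronglyMeasurable (by fun_prop)).mul hh.1) ?_ (hh.norm.const_mul _)
    (Eventually.of_forall fun t w _ => hderiv w t)).2.differentiableAt
  filter_upwards [hm] with t ht w hw
  have hσ : |t| ≤ |σ| := ht.trans (le_abs_self σ)
  have hwz : ‖w‖ ≤ ‖z‖ + 1 := by
    linarith [norm_sub_norm_le w z, mem_ball_iff_norm.1 hw]
  rw [norm_mul, norm_mul, norm_mul Complex.I, Complex.norm_I, one_mul, Complex.norm_real,
    Real.norm_eq_abs]
  gcongr
  exact (norm_exp_I_mul_mul_le w hσ).trans (by gcongr)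

theorem isEntireOfExpType_integral (hh : Integrable h m) (hm : ∀ᵐ t ∂m, |t| ≤ σ) :
    IsEntireOfExpType σ fun z => ∫ t : ℝ, Complex.exp (Complex.I * z * t) * h t ∂m := by
  refine isEntireOfExpType_of_norm_le (C := ∫ t, ‖h t‖ ∂m)
    (differentiable_integral_exp_I_mul hh hm) fun z => ?_
  rw [mul_comm (∫ t, ‖h t‖ ∂m), ← integral_const_mul]
  exact norm_integral_le_of_norm_le (hh.norm.const_mul _) (ae_norm_exp_mul_le hm z)

theorem exists_isEntireOfExpType_eq_fourierStieltjes (ν : ComplexMeasure ℝ)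
    [IsFiniteMeasure ν.variation] (hν : ∀ᵐ t ∂ν.variation, |t| ≤ σ) :
    ∃ g, IsEntireOfExpType σ g ∧ ∀ x : ℝ, g x = fourierStieltjes ν x :=
  ⟨_, isEntireOfExpType_integral (ComplexMeasure.integrable_rnDeriv ν ν.variation) hν, fun x =>
    (integral_eq_integral_mul_rnDeriv_variation (integrable_exp_I_mul_mul _ x)).symm⟩

theorem exists_isEntireOfExpType_eq_phi₀ {F : ℝ → ℂ} (hF : IsBVCircle F) :
    ∃ g, IsEntireOfExpType π g ∧ ∀ x : ℝ, g x = phi₀ hF x := by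
  have hIco : ∀ᵐ t ∂(dStieltjes hF).variation, t ∈ Ico (-π) π := by
    rw [← dStieltjes_restrict hF, VectorMeasure.variation_restrict measurableSet_Ico]
    exact ae_restrict_mem measurableSet_Ico
  obtain ⟨g, hg, hgx⟩ := exists_isEntireOfExpType_eq_fourierStieltjes (dStieltjes hF)
    (hIco.mono fun t ht => abs_le.2 ⟨ht.1, ht.2.le⟩)
  refine ⟨_, hg.comp_neg, fun x => ?_⟩
  rw [phi₀_eq_fourierStieltjes, ← hgx, Complex.ofReal_neg]

end FourierIntegral

end ExponentialType

section Growth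

variable {f h s : ℂ → ℂ} {a σ C M : ℝ}

theorem differentiable_dslope (hf : Differentiable ℂ f) (w : ℂ) :
    Differentiable ℂ (dslope f w) :=
  differentiableOn_univ.1 ((Complex.differentiableOn_dslope univ_mem).2 hf.differentiableOn)

theorem dslope_div_dslope_of_ne {w z : ℂ} (hh : h w = 0) (hs : s w = 0) (hzw : z ≠ w) :
    dslope h w z / dslope s w z = h z / s z := by
  rw [dslope_of_ne _ hzw, dslope_of_ne _ hzw, slope_def_field, slope_def_field, hh, hs,
    sub_zero, sub_zero, div_div_div_cancel_right₀ (sub_ne_zero.2 hzw)]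

theorem exists_differentiable_quotient (hh : Differentiable ℂ h) (hs : Differentiable ℂ s)
    (h₀ : ∀ z, s z = 0 → h z = 0 ∧ deriv s z ≠ 0) :
    ∃ q : ℂ → ℂ, Differentiable ℂ q ∧ ∀ z, h z = q z * s z := by
  classical
  let q : ℂ → ℂ := fun z => if s z = 0 then deriv h z / deriv s z else h z / s z
  have hq {z : ℂ} (hz : s z ≠ 0) : q z = h z / s z := if_neg hz
  refine ⟨q, fun w => ?_, fun z => ?_⟩
  · by_cases hw : s w = 0
    · obtain ⟨hhw, hsw⟩ := h₀ w hw
      rw [← dslope_same] at hsw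
      refine ((differentiable_dslope hh w w).div (differentiable_dslope hs w w)
        hsw).congr_of_eventuallyEq ?_
      filter_upwards [(differentiable_dslope hs w).continuous.continuousAt.eventually_ne hsw]
        with z hz
      rcases eq_or_ne z w with rfl | hzw
      · simp only [q, if_pos hw, Pi.div_apply, dslope_same]
      · have hsz : s z ≠ 0 := by
          simpa [dslope_of_ne _ hzw, slope_def_field, hw, sub_ne_zero.2 hzw] using hz
        rw [hq hsz, Pi.div_apply, dslope_div_dslope_of_ne hhw hw hzw]
    · exact ((hh w).div (hs w) hw).congr_of_eventuallyEq
        ((hs.continuous.continuousAt.eventually_ne hw).mono fun z hz => hq hz)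
  · by_cases hz : s z = 0
    · rw [hz, (h₀ z hz).1, mul_zero]
    · rw [hq hz, div_mul_cancel₀ _ hz]

theorem norm_le_mul_exp_im_of_norm_le_mul_exp_norm (hh : Differentiable ℂ h)
    (hC : ∀ z, ‖h z‖ ≤ C * Real.exp (a * ‖z‖)) (hM : ∀ x : ℝ, ‖h x‖ ≤ M) {z : ℂ}
    (hz : 0 ≤ z.im) : ‖h z‖ ≤ M * Real.exp (a * z.im) := by
  have hC0 : 0 ≤ C := by simpa using (norm_nonneg _).trans (hC 0)
  -- the exponential factor makes `f` bounded on the positive half-line, while `‖f‖ = ‖h‖` on `iℝ`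
  let f : ℂ → ℂ := fun w => h (Complex.I * w) * Complex.exp (-(a * w))
  have hf (w : ℂ) : ‖f w‖ = ‖h (Complex.I * w)‖ * Real.exp (-(a * w.re)) := by
    rw [norm_mul, Complex.norm_exp, Complex.neg_re, Complex.re_ofReal_mul]
  have hfC (w : ℂ) : ‖f w‖ ≤ C * Real.exp (a * ‖w‖ - a * w.re) := by
    rw [hf, sub_eq_add_neg, Real.exp_add, ← mul_assoc]
    gcongr
    simpa using hC (Complex.I * w)
  have hdiff : Differentiable ℂ f := (hh.comp (differentiable_id.const_mul _)).mul (by fun_prop)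
  have hgrowth (w : ℂ) : ‖f w‖ ≤ C * ‖Real.exp ((a + |a|) * ‖w‖ ^ (1 : ℝ))‖ := by
    refine (hfC w).trans ?_
    rw [Real.norm_of_nonneg (Real.exp_pos _).le, Real.rpow_one, add_mul, sub_eq_add_neg]
    gcongr
    calc -(a * w.re) ≤ |a| * |w.re| := abs_mul a _ ▸ neg_le_abs _
      _ ≤ |a| * ‖w‖ := by gcongr; exact Complex.abs_re_le_norm w
  have hreal : IsBoundedUnder (· ≤ ·) atTop fun x : ℝ => ‖f x‖ := by
    refine isBoundedUnder_of_eventually_le (a := C) ?_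
    filter_upwards [eventually_ge_atTop 0] with x hx
    simpa [abs_of_nonneg hx] using hfC x
  have himag (x : ℝ) : ‖f (x * Complex.I)‖ ≤ M := by
    have hrot : Complex.I * (x * Complex.I) = ((-x : ℝ) : ℂ) := by
      push_cast
      linear_combination (x : ℂ) * Complex.I_mul_I
    simpa [hf, hrot] using hM (-x)
  have hfz := PhragmenLindelof.right_half_plane_of_bounded_on_real hdiff.diffContOnCl
    ⟨1, one_lt_two, _, .of_bound C (Eventually.of_forall hgrowth)⟩ hreal himag
    (z := -Complex.I * z) (by simpa using hz)
  have hrot : Complex.I * (-Complex.I * z) = z := by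
    linear_combination -z * Complex.I_mul_I
  rw [hf, hrot, Real.exp_neg, ← div_eq_mul_inv, div_le_iff₀ (Real.exp_pos _)] at hfz
  simpa using hfz

namespace IsEntireOfExpType

theorem norm_le_of_im_nonneg (hh : IsEntireOfExpType σ h) (hM : ∀ x : ℝ, ‖h x‖ ≤ M) {z : ℂ}
    (hz : 0 ≤ z.im) : ‖h z‖ ≤ M * Real.exp (σ * z.im) := by
  have hlim : Tendsto (fun ε : ℝ => M * Real.exp ((σ + ε) * z.im)) (𝓝[>] 0)
      (𝓝 (M * Real.exp (σ * z.im))) :=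
    tendsto_nhdsWithin_of_tendsto_nhds (Continuous.tendsto' (by fun_prop) _ _ (by simp))
  refine ge_of_tendsto hlim (eventually_mem_nhdsWithin.mono fun ε hε => ?_)
  obtain ⟨C, hC⟩ := hh.2 ε hε
  exact norm_le_mul_exp_im_of_norm_le_mul_exp_norm hh.1 hC hM hz

theorem norm_le_mul_exp_abs_im (hh : IsEntireOfExpType σ h) (hM : ∀ x : ℝ, ‖h x‖ ≤ M) (z : ℂ) :
    ‖h z‖ ≤ M * Real.exp (σ * |z.im|) := by
  rcases le_total 0 z.im with hz | hz
  · rw [abs_of_nonneg hz]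
    exact hh.norm_le_of_im_nonneg hM hz
  · rw [abs_of_nonpos hz]
    simpa using hh.comp_neg.norm_le_of_im_nonneg (z := -z) (fun x => by simpa using hM (-x))
      (by simpa using hz)

end IsEntireOfExpType

theorem sinh_abs_im_le_norm_sin (z : ℂ) : Real.sinh |z.im| ≤ ‖Complex.sin z‖ := by
  have h₁ : ‖Complex.exp (-z * Complex.I)‖ = Real.exp z.im := by simp [Complex.norm_exp]
  have h₂ : ‖Complex.exp (z * Complex.I)‖ = Real.exp (-z.im) := by simp [Complex.norm_exp]
  have h₃ := abs_norm_sub_norm_le (Complex.exp (-z * Complex.I)) (Complex.exp (z * Complex.I))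
  rw [Complex.sin, norm_div, norm_mul, Complex.norm_I, mul_one, Complex.norm_two,
    ← Real.abs_sinh, Real.sinh_eq, abs_div, abs_two, ← h₁, ← h₂]
  gcongr

theorem norm_sin_of_re_eq {z : ℂ} {n : ℤ} (hz : z.re = n * π + π / 2) :
    ‖Complex.sin z‖ = Real.cosh z.im := by
  have hper : Function.Periodic (fun w => ‖Complex.sin w‖) π := fun w => by
    simp only [Complex.sin_add_pi, norm_neg]
  have hz' : z = z.im * Complex.I + π / 2 + n * π := by
    conv_lhs => rw [← Complex.re_add_im z, hz]
    push_cast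
    ring
  have h := hper.int_mul n (z.im * Complex.I + π / 2)
  rw [← hz', Complex.sin_add_pi_div_two, Complex.cos_mul_I, ← Complex.ofReal_cosh,
    Complex.norm_of_nonneg (Real.cosh_pos _).le] at h
  exact h

theorem exp_le_norm_sin_of_one_le_abs_im {z : ℂ} (hz : 1 ≤ |z.im|) :
    Real.exp |z.im| ≤ 4 * ‖Complex.sin z‖ := by
  have h₁ := sinh_abs_im_le_norm_sin z
  have h₂ : Real.exp (-|z.im|) ≤ 1 := Real.exp_le_one_iff.2 (by linarith)
  have h₃ := Real.add_one_le_exp |z.im|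
  rw [Real.sinh_eq] at h₁
  linarith

theorem exp_le_norm_sin_of_re_eq {z : ℂ} {n : ℤ} (hz : z.re = n * π + π / 2) :
    Real.exp |z.im| ≤ 4 * ‖Complex.sin z‖ := by
  rw [norm_sin_of_re_eq hz, ← Real.cosh_abs, Real.cosh_eq]
  linarith [Real.exp_pos |z.im|, Real.exp_pos (-|z.im|)]

theorem norm_le_of_norm_le_on_lines {q : ℂ → ℂ} {b p r : ℝ} (hq : Differentiable ℂ q)
    (hp : 0 < p) (him : ∀ z : ℂ, r ≤ |z.im| → ‖q z‖ ≤ C)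
    (hre : ∀ (n : ℤ) (z : ℂ), z.re = b + n * p → ‖q z‖ ≤ C) (z : ℂ) : ‖q z‖ ≤ C := by
  rcases le_or_gt r |z.im| with hz | hz
  · exact him z hz
  have hr : 0 < r := (abs_nonneg _).trans_lt hz
  obtain ⟨n, hn, -⟩ := existsUnique_sub_zsmul_mem_Ico hp z.re b
  rw [zsmul_eq_mul] at hn
  have hlt : b + n * p < b + (n + 1 : ℤ) * p := by push_cast; linarith
  have hneg : -r < r := by linarith
  refine Complex.norm_le_of_forall_mem_frontier_norm_le
    (U := Ioo (b + n * p) (b + (n + 1 : ℤ) * p) ×ℂ Ioo (-r) r)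
    ((Metric.isBounded_Ioo _ _).reProdIm (Metric.isBounded_Ioo _ _)) hq.diffContOnCl
    (fun w hw => ?_) ?_
  · rw [Complex.frontier_reProdIm, frontier_Ioo hlt, frontier_Ioo hneg] at hw
    rcases hw with ⟨-, hw | hw⟩ | ⟨hw | hw, -⟩
    · exact him w (by rw [show w.im = -r from hw, abs_neg]; exact le_abs_self r)
    · exact him w (by rw [show w.im = r from hw]; exact le_abs_self r)
    · exact hre n w hw
    · exact hre (n + 1) w hw
  · rw [Complex.closure_reProdIm, closure_Ioo hlt.ne, closure_Ioo hneg.ne]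
    refine ⟨⟨by linarith [hn.1], ?_⟩, abs_le.1 hz.le⟩
    push_cast
    linarith [hn.2]

theorem exists_differentiable_eq_mul_sin (hh : Differentiable ℂ h) (h₀ : ∀ k : ℤ, h k = 0) :
    ∃ q : ℂ → ℂ, Differentiable ℂ q ∧ ∀ z, h z = q z * Complex.sin (π * z) := by
  have hpi : (π : ℂ) ≠ 0 := Complex.ofReal_ne_zero.2 pi_ne_zero
  have hs (z : ℂ) :
      HasDerivAt (fun z : ℂ => Complex.sin (π * z)) (Complex.cos (π * z) * π) z := by
    simpa using ((hasDerivAt_id z).const_mul (π : ℂ)).csin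
  refine exists_differentiable_quotient hh (fun z => (hs z).differentiableAt) fun z hz => ?_
  obtain ⟨k, hk⟩ := Complex.sin_eq_zero_iff.1 hz
  have hzk : z = k := mul_left_cancel₀ hpi (hk.trans (mul_comm _ _))
  refine ⟨hzk ▸ h₀ k, ?_⟩
  rw [(hs z).deriv]
  refine mul_ne_zero (fun hcos => ?_) hpi
  simpa [hz, hcos] using Complex.sin_sq_add_cos_sq (π * z)

theorem IsEntireOfExpType.exists_eq_mul_sin (hh : IsEntireOfExpType π h)
    (hM : ∀ x : ℝ, ‖h x‖ ≤ M) (h₀ : ∀ k : ℤ, h k = 0) :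
    ∃ l : ℂ, ∀ z, h z = l * Complex.sin (π * z) := by
  obtain ⟨q, hq, hqs⟩ := exists_differentiable_eq_mul_sin hh.1 h₀
  have hM0 : 0 ≤ M := (norm_nonneg _).trans (hM 0)
  have him (z : ℂ) : |((π : ℂ) * z).im| = π * |z.im| := by
    rw [Complex.im_ofReal_mul, abs_mul, abs_of_pos pi_pos]
  have hlocal {z : ℂ} (hz : Real.exp |((π : ℂ) * z).im| ≤ 4 * ‖Complex.sin (π * z)‖) :
      ‖q z‖ ≤ 4 * M := by
    have hpos : 0 < ‖Complex.sin (π * z)‖ := by linarith [Real.exp_pos |((π : ℂ) * z).im|]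
    refine le_of_mul_le_mul_right ?_ hpos
    calc ‖q z‖ * ‖Complex.sin (π * z)‖ = ‖h z‖ := by rw [hqs, norm_mul]
      _ ≤ M * Real.exp |((π : ℂ) * z).im| := him z ▸ hh.norm_le_mul_exp_abs_im hM z
      _ ≤ M * (4 * ‖Complex.sin (π * z)‖) := by gcongr
      _ = 4 * M * ‖Complex.sin (π * z)‖ := by ring
  have hbound : ∀ z, ‖q z‖ ≤ 4 * M := by
    refine norm_le_of_norm_le_on_lines (r := 1) (b := 1 / 2) hq one_pos (fun z hz => ?_)
      fun n z hz => hlocal (exp_le_norm_sin_of_re_eq (n := n) ?_)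
    · refine hlocal (exp_le_norm_sin_of_one_le_abs_im ?_)
      rw [him]
      nlinarith [pi_gt_three]
    · rw [Complex.re_ofReal_mul, hz]
      ring
  have hrange : Bornology.IsBounded (range q) :=
    isBounded_iff_forall_norm_le.2 ⟨4 * M, by rintro _ ⟨z, rfl⟩; exact hbound z⟩
  exact ⟨q 0, fun z => by rw [hqs, hq.apply_eq_apply_of_bounded hrange z 0]⟩

end Growth

theorem entire_extension_iff {F φ : ℝ → ℂ} {c : ℤ → ℂ} (hF : IsBVCircle F)
    (hc : IsFourierStieltjesSeries c hF) :
    (φ ∈ W ∧ Extends φ c ∧ ∃ g : ℂ → ℂ, IsEntireOfExpType π g ∧ ∀ x : ℝ, g x = φ x) ↔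
      ∃ l : ℂ, ∀ x : ℝ, φ x = phi₀ hF x + l * Real.sin (π * x) := by
  obtain ⟨g₀, hg₀, hg₀φ⟩ := exists_isEntireOfExpType_eq_phi₀ hF
  constructor
  · rintro ⟨⟨μ, hμ⟩, hφc, g, hg, hgφ⟩
    obtain ⟨l, hl⟩ := (hg.sub hg₀).exists_eq_mul_sin
      (fun x => by
        rw [Pi.sub_apply, hgφ, hg₀φ]
        exact norm_sub_le_of_le (hμ.norm_le x) ((represents_phi₀ hF).norm_le x))
      (fun k => by
        rw [Pi.sub_apply, ← Complex.ofReal_intCast, hgφ, hg₀φ, hφc, extends_phi₀ hF hc, sub_self])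
    refine ⟨l, fun x => ?_⟩
    rw [← hgφ, ← hg₀φ, Complex.ofReal_sin, Complex.ofReal_mul, ← hl, Pi.sub_apply,
      add_sub_cancel]
  · rintro ⟨l, hl⟩
    have hsin : IsEntireOfExpType π fun z => Complex.sin (π * z) := by
      simpa only [abs_of_pos pi_pos] using isEntireOfExpType_sin π
    refine ⟨?_, fun k => ?_, _, hg₀.add (hsin.const_mul l), fun x => ?_⟩
    · rw [show φ = phi₀ hF + fun x : ℝ => l * Real.sin (π * x) from funext hl]
      exact add_mem_W (phi₀_mem_W hF) (const_mul_sin_mem_W π l)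
    · rw [hl, mul_comm π, Real.sin_int_mul_pi, Complex.ofReal_zero, mul_zero, add_zero,
        extends_phi₀ hF hc]
    · rw [Pi.add_apply, hl, hg₀φ, Complex.ofReal_sin, Complex.ofReal_mul]

end WienerSeries

theorem theorem1 (c : ℤ → ℂ) :
    -- Fourier–Stieltjes series
    ((∃ (F : ℝ → ℂ) (hF : WienerSeries.IsBVCircle F), WienerSeries.IsFourierStieltjesSeries c hF) ↔
      ∃ φ ∈ WienerSeries.W, WienerSeries.Extends φ c) ∧
    -- Fourier series
    (WienerSeries.IsFourierSeries c ↔ ∃ φ ∈ WienerSeries.W₀, WienerSeries.Extends φ c) ∧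
    ∀ (F : ℝ → ℂ) (hF : WienerSeries.IsBVCircle F), WienerSeries.IsFourierStieltjesSeries c hF →
      -- the total variation of `F` is the minimal norm of an extension
      IsLeast {r : ℝ | ∃ φ ∈ WienerSeries.W, WienerSeries.Extends φ c ∧ r = WienerSeries.wNorm φ}
        (WienerSeries.totalVar F) ∧
      -- the minimum is attained at `φ₀`, which is in `W₀` in the case of a Fourier series
      (WienerSeries.phi₀ hF ∈ WienerSeries.W ∧ WienerSeries.Extends (WienerSeries.phi₀ hF) c ∧
        WienerSeries.wNorm (WienerSeries.phi₀ hF) = WienerSeries.totalVar F) ∧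
      (WienerSeries.IsFourierSeries c → WienerSeries.phi₀ hF ∈ WienerSeries.W₀) ∧
      -- the extensions that are entire functions of exponential type at most `π`
      (∀ φ : ℝ → ℂ,
        (φ ∈ WienerSeries.W ∧ WienerSeries.Extends φ c ∧
          ∃ g : ℂ → ℂ, WienerSeries.IsEntireOfExpType Real.pi g ∧ ∀ x : ℝ, g x = φ x) ↔
        ∃ l : ℂ, ∀ x : ℝ, φ x = WienerSeries.phi₀ hF x + l * Real.sin (Real.pi * x)) ∧
      -- increasing `F` and positive definite extensions
      (WienerSeries.IsIncreasing F ↔ ∃ φ ∈ WienerSeries.WPos, WienerSeries.Extends φ c) := by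
  open WienerSeries in
  refine ⟨exists_isFourierStieltjesSeries_iff, isFourierSeries_iff, fun F hF hc =>
    ⟨isLeast_wNorm hF hc, ⟨phi₀_mem_W hF, extends_phi₀ hF hc, wNorm_phi₀ hF hc⟩,
      phi₀_mem_W₀ hF hc, fun φ => entire_extension_iff hF hc, isIncreasing_iff hF hc⟩⟩
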